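/- Let $G=(V,E)$ be a finite connected non-empty graph, loops and multiple edges allowed. A *tropical curve* $\Gamma$ on $G$ assigns to every edge $e$ a length $\ell(e)\in(0,\infty]$, where $\ell(e)=\infty$ is allowed only if an end of $e$ is a vertex of degree one; each edge is identified with the interval $[0,\ell(e)]$ whose ends are glued to the end vertices of $e$, the point $\infty$ of an infinite edge being glued to a vertex of degree one (an *unbounded end*). The points of $\Gamma$ are all points of these intervals, unbounded ends included. If all lengths are finite, $\Gamma$ is a *metric graph*. The *genus* is $g=|E|-|V|+1$. Let $\mathrm{Div}(\Gamma)$ be the free abelian group on the points of $\Gamma$, $\deg(D)=\sum_v D(v)$, write $D\ge 0$ if all coefficients are non-negative, and let $K_\Gamma=\sum_{v\in V}(\deg(v)-2)(v)$. A *rational function* is a continuous $f:\Gamma\to\mathbb R\cup\{\pm\infty\}$, finite except possibly at unbounded ends, which on each edge is piecewise linear with finitely many linear parts and integral slopes; $D_f(v)$ is the sum of the outgoing slopes of $f$ at $v$. Put $D\sim D'$ if $D=D'+D_f$ for some rational function $f$, $|D|=\{E\ge 0: E\sim D\}$, and $$r(D)=\min\{\deg(E): E\ge 0,\ |D-E|=\emptyset\}-1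 .$$ Let $\mathcal N=\{D:\deg(D)=g-1,\ |D|=\emptyset\}$, and let $\epsilon(D)\in\mathbb Z/2\mathbb Z$ be $0$ if $|D|\ne\emptyset$ and $1$ if $|D|=\emptyset$. **Theorem.** (1) If $\Gamma$ is a metric graph, then * (RR1) for every $D\in\mathrm{Div}(\Gamma)$ there is $\nu\in\mathcal N$ with $\epsilon(D)+\epsilon(\nu-D)=1$; * (RR2) for every $D\in\mathrm{Div}(\Gamma)$ with $\deg(D)=g-1$, $\epsilon(D)+\epsilon(K_\Gamma-D)=0$. (2) For every tropical curve $\Gamma$ of genus $g$ and every $D\in\mathrm{Div}(\Gamma)$, the minimum defining $r(D)$ exists, and $$r(D)-r(K_\Gamma-D)=\deg(D)+1-g .$$ -/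

import Mathlib

open Filter Topology

/-- The combinatorial data of an abstract tropical curve with vertex set `V` and edge set `E`
(multiple edges and loops allowed). The edge `e` is the interval `[0, length e]`, with `0` glued to
`src e` and `length e` glued to `tgt e`. Edges of infinite length are allowed only when the end `∞`
is glued to a vertex of degree one (an unbounded end). -/
structure TropicalCurve (V : Type*) (E : Type*) where
  src : E → V
  tgt : E → V
  length : E → EReal
  length_pos : ∀ e, 0 < length e
  /-- The vertex at the end `∞` of an infinite edge is incident with nothing else. -/
  infinite_leaf : ∀ e, length e = ⊤ →
    (∀ e', src e' ≠ tgt e) ∧ (∀ e', tgt e' = tgt e → e' = e)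

namespace TropicalCurve

variable {V : Type*} {E : Type*} (Γ : TropicalCurve V E)

/-- A metric graph is a tropical curve all of whose edges have finite length. -/
def IsMetricGraph : Prop := ∀ e, Γ.length e ≠ ⊤

/-- The underlying graph is connected (in particular non-empty). -/
def IsConnected : Prop :=
  (SimpleGraph.fromRel fun u v => ∃ e, Γ.src e = u ∧ Γ.tgt e = v).Connected

/-- The points of the tropical curve: the vertices (including the unbounded ends) and the internal
points of the edges. -/
inductive Point : Type _
  | vertex (v : V) : Point
  | interior (e : E) (t : ℝ) (pos : 0 < t) (lt : (t : EReal) < Γ.length e) : Point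

open Classical in
/-- The parametrization of the edge `e` by `[0, length e]` (extended by the end vertices outside
this interval). -/
noncomputable def param (e : E) (t : EReal) : Γ.Point :=
  if h : 0 < t.toReal ∧ (t.toReal : EReal) < Γ.length e then
    Point.interior e t.toReal h.1 h.2
  else if t ≤ 0 then Point.vertex (Γ.src e) else Point.vertex (Γ.tgt e)

/-- The quotient topology: the finest topology for which all the parametrizations
`[0, length e] → Γ` are continuous. -/
noncomputable instance : TopologicalSpace Γ.Point :=
  ⨆ e : E, TopologicalSpace.coinduced
    (fun t : Set.Icc (0 : EReal) (Γ.length e) => Γ.param e t) inferInstance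

/-- The points `∞` of the infinite edges. -/
def IsUnboundedEnd (p : Γ.Point) : Prop :=
  ∃ e, Γ.length e = ⊤ ∧ p = Point.vertex (Γ.tgt e)

/-- Rational functions: continuous functions to `ℝ ∪ {±∞}`, finite away from the unbounded ends,
which on every edge are piecewise linear with integral slopes and finitely many linear parts. The
breakpoints on the edge `e` are contained in the finite set `S`. -/
structure IsRational (f : Γ.Point → EReal) : Prop where
  continuous : Continuous f
  finite : ∀ p, f p = ⊤ ∨ f p = ⊥ → Γ.IsUnboundedEnd p
  piecewise_linear : ∀ e, ∃ S : Finset ℝ, ∀ a b : ℝ, 0 ≤ a → (b : EReal) ≤ Γ.length e →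
    (∀ s ∈ S, s ∉ Set.Ioo a b) →
    ∃ (m : ℤ) (c : ℝ), ∀ t ∈ Set.Ioo a b, f (Γ.param e (t : EReal)) = ((m * t + c : ℝ) : EReal)

/-- Along the filter `F` on the parameters of the edge `e`, the function `f` is eventually linear
of slope `m` (in the direction from `src e` to `tgt e`). -/
def HasSlope (f : Γ.Point → EReal) (e : E) (F : Filter ℝ) (m : ℤ) : Prop :=
  ∃ c : ℝ, ∀ᶠ t : ℝ in F, f (Γ.param e (t : EReal)) = ((m * t + c : ℝ) : EReal)

/-- The slope of `f` on the edge `e` along `F` (it exists if `f` is rational and `F` is one of the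
filters below, and it is then unique). -/
noncomputable def slope (f : Γ.Point → EReal) (e : E) (F : Filter ℝ) : ℤ :=
  Classical.epsilon (Γ.HasSlope f e F)

open Classical in
/-- The parameters of the edge `e` approaching its end `length e` (finite or infinite). -/
noncomputable def endFilter (e : E) : Filter ℝ :=
  if Γ.length e = ⊤ then atTop else 𝓝[<] (Γ.length e).toReal

open Classical in
/-- The order of `f` at a point: the sum of the outgoing slopes of all the segments emanating from
that point. A loop contributes two segments at its vertex. -/
noncomputable def ord [Fintype E] (f : Γ.Point → EReal) : Γ.Point → ℤ
  | Point.vertex v =>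
      (∑ e : E, if Γ.src e = v then Γ.slope f e (𝓝[>] 0) else 0) +
      ∑ e : E, if Γ.tgt e = v then -Γ.slope f e (Γ.endFilter e) else 0
  | Point.interior e t _ _ => Γ.slope f e (𝓝[>] t) - Γ.slope f e (𝓝[<] t)

/-- Divisors: the free abelian group on the set of all points. Effective divisors are those `≥ 0`
for the pointwise order. -/
abbrev Divisor : Type _ := Γ.Point →₀ ℤ

/-- The degree of a divisor. -/
def deg {Γ : TropicalCurve V E} (D : Γ.Divisor) : ℤ := D.sum fun _ n => n

/-- Linear equivalence: `D = D' + D_f` for a rational function `f`. -/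
def Equivalent [Fintype E] (D D' : Γ.Divisor) : Prop :=
  ∃ f : Γ.Point → EReal, Γ.IsRational f ∧ ∀ p, D p = D' p + Γ.ord f p

/-- The complete linear system `|D|`. -/
def linearSystem [Fintype E] (D : Γ.Divisor) : Set Γ.Divisor :=
  {D' | 0 ≤ D' ∧ Γ.Equivalent D' D}

/-- The integers `deg E - 1` for effective `E` with `|D - E| = ∅`. -/
def rankSet [Fintype E] (D : Γ.Divisor) : Set ℤ :=
  {n | ∃ D' : Γ.Divisor, 0 ≤ D' ∧ Γ.linearSystem (D - D') = ∅ ∧ n = deg D' - 1}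

/-- The rank `r(D)`, the minimum of `rankSet D`. -/
noncomputable def rank [Fintype E] (D : Γ.Divisor) : ℤ := sInf (Γ.rankSet D)

/-- The genus `|E| - |V| + 1`. -/
def genus [Fintype V] [Fintype E] (_Γ : TropicalCurve V E) : ℤ :=
  (Fintype.card E : ℤ) - (Fintype.card V : ℤ) + 1

open Classical in
/-- The degree (valence) of a vertex; a loop counts twice. -/
noncomputable def valence [Fintype E] (v : V) : ℤ :=
  (∑ e : E, if Γ.src e = v then 1 else 0) + ∑ e : E, if Γ.tgt e = v then 1 else 0

/-- The canonical divisor `K = ∑ (deg v - 2) (v)`. -/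
noncomputable def canonical [Fintype V] [Fintype E] : Γ.Divisor :=
  ∑ v : V, Finsupp.single (Point.vertex v) (Γ.valence v - 2)

/-- The set of non-special divisors: degree `g - 1` and empty linear system. -/
def nonSpecial [Fintype V] [Fintype E] : Set Γ.Divisor :=
  {D | deg D = Γ.genus - 1 ∧ Γ.linearSystem D = ∅}

open Classical in
/-- `ε(D) = 0` if `|D| ≠ ∅`, and `ε(D) = 1` if `|D| = ∅`. -/
noncomputable def eps [Fintype E] (D : Γ.Divisor) : ZMod 2 :=
  if Γ.linearSystem D = ∅ then 1 else 0

/-- Condition (RR1). -/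
def RR1 [Fintype V] [Fintype E] : Prop :=
  ∀ D : Γ.Divisor, ∃ ν ∈ Γ.nonSpecial, Γ.eps D + Γ.eps (ν - D) = 1

/-- Condition (RR2). -/
def RR2 [Fintype V] [Fintype E] : Prop :=
  ∀ D : Γ.Divisor, deg D = Γ.genus - 1 → Γ.eps D + Γ.eps (Γ.canonical - D) = 0

end TropicalCurve

/-! Fix vertex values `x`. A function with these values that makes `D` effective inside an edge
leaves the tail of a dart with integral slope at most `⌊rise⌋`; the bounds at both ends of the edge
are attained together, at the cost of at most one chip inside it. So `|D| ≠ ∅` becomes a condition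
on real vertex values: `Γ.Eff D` asks for `x` with all vertex coefficients `net` non-negative. An
infinite edge acts as an edge of length one whose interior chips sit at the unbounded end, so
tropical curves are treated together with metric graphs.

The heart is `exists_moderator`. If `D` is not effective, the greatest vector making it effective
away from a base vertex `q` (`exists_greatest_feasible`) plays the role of a `q`-reduced divisor.
Dhar's burning argument orders the vertices so that each has fewer chips than integral darts to
earlier vertices (`exists_order_of_not_effective`). Orient the edges by this order and put a chip
inside each loop and each edge of non-integral rise. The divisor "indegree minus one" is then some
`ν` of degree `g - 1` with `|ν - D|` non-empty. Neither `ν` nor `K - ν`, which belongs to the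
reversed orientation, is effective: look at the earliest vertex among those where a function is
maximal (`not_effective_of_order`).

The rest is formal. If `|D - F| = ∅`, take `ν` for `D - F` and `F' ∈ |ν - D + F|`. Then `K - D - F'`
is equivalent to `K - ν - F`, which is not effective since `K - ν` is not. Comparing degrees gives
one inequality of Riemann–Roch, and replacing `D` by `K - D` gives the other. (RR1) and (RR2) come
from the same `ν`. -/

/-- A finite weighted multigraph, given by its darts (oriented edges). -/
structure DartGraph (V A : Type*) where
  tail : A → V
  rev : A → A
  len : A → ℝ
  rev_rev : ∀ a, rev (rev a) = a
  len_pos : ∀ a, 0 < len a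
  len_rev : ∀ a, len (rev a) = len a

/-! ### Effectivity in terms of vertex values on a weighted graph -/

namespace DartGraph

variable {V A : Type*} (G : DartGraph V A)

/-- The end vertex of a dart. -/
def head (a : A) : V := G.tail (G.rev a)

/-- The average slope along the dart `a` of a function with vertex values `x`, shifted by `α`. -/
noncomputable def rise (α : A → ℝ) (x : V → ℝ) (a : A) : ℝ :=
  (x (G.head a) - x (G.tail a) + α a) / G.len a

lemma head_rev (a : A) : G.head (G.rev a) = G.tail a := by simp [head, G.rev_rev]

lemma rise_add (α β : A → ℝ) (x y : V → ℝ) (a : A) :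
    G.rise (α + β) (x + y) a = G.rise α x a + G.rise β y a := by
  simp only [rise, Pi.add_apply]; ring

/-- The floor is right-continuous. This lets feasibility pass to suprema. -/
lemma eventually_floor_add_div (y c : ℝ) :
    ∀ᶠ ε in 𝓝[>] (0 : ℝ), ⌊y + ε / c⌋ ≤ ⌊y⌋ := by
  have h1 : Tendsto (fun ε : ℝ => y + ε / c) (𝓝[>] 0) (𝓝 y) := by
    have : Continuous fun ε : ℝ => y + ε / c := by fun_prop
    simpa using (this.tendsto 0).mono_left nhdsWithin_le_nhds
  filter_upwards [h1.eventually (gt_mem_nhds (Int.lt_floor_add_one y))] with ε hε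
  rw [← Int.lt_add_one_iff, Int.floor_lt]
  exact_mod_cast hε

-- A small decrease lowers the floor by at most one, and only when it starts at an integer. This is
-- why burning counts integral darts.
open Classical in
lemma eventually_floor_sub_div (y : ℝ) {c : ℝ} :
    ∀ᶠ ε in 𝓝[>] (0 : ℝ), ⌊y⌋ - (if ∃ n : ℤ, y = n then 1 else 0) ≤ ⌊y - ε / c⌋ := by
  have h1 : Tendsto (fun ε : ℝ => y - ε / c) (𝓝[>] 0) (𝓝 y) := by
    have : Continuous fun ε : ℝ => y - ε / c := by fun_prop
    simpa using (this.tendsto 0).mono_left nhdsWithin_le_nhds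
  have h2 : ((⌊y⌋ - (if ∃ n : ℤ, y = n then 1 else 0) : ℤ) : ℝ) < y := by
    split_ifs with h
    · push_cast
      linarith [Int.floor_le y]
    · push_cast
      rw [sub_zero]
      exact lt_of_le_of_ne (Int.floor_le y) fun h' => h ⟨_, h'.symm⟩
  filter_upwards [h1.eventually (lt_mem_nhds h2)] with ε hε
  rw [Int.le_floor]
  exact hε.le

variable [Fintype A]

open Classical in
/-- The value at `v` of the divisor with vertex part `d` and edge shifts `α` after adding the
divisor of the best function with vertex values `x`. -/
noncomputable def net (d : V → ℤ) (α : A → ℝ) (x : V → ℝ) (v : V) : ℤ :=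
  d v + ∑ a with G.tail a = v, ⌊G.rise α x a⌋

/-- Some function makes all the vertex values non-negative. -/
def Effective (d : V → ℤ) (α : A → ℝ) : Prop := ∃ x, ∀ v, 0 ≤ G.net d α x v

open Classical in
lemma net_add_le (d d' : V → ℤ) (α β : A → ℝ) (x y : V → ℝ) (v : V) :
    G.net d α x v + G.net d' β y v ≤ G.net (d + d') (α + β) (x + y) v := by
  have : ∑ a with G.tail a = v, ⌊G.rise α x a⌋ + ∑ a with G.tail a = v, ⌊G.rise β y a⌋
      ≤ ∑ a with G.tail a = v, ⌊G.rise (α + β) (x + y) a⌋ := by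
    rw [← Finset.sum_add_distrib]
    refine Finset.sum_le_sum fun a _ => ?_
    rw [rise_add]
    exact Int.le_floor_add _ _
  simp only [net, Pi.add_apply]
  linarith

lemma Effective.add {d d' : V → ℤ} {α β : A → ℝ} (h : G.Effective d α) (h' : G.Effective d' β) :
    G.Effective (d + d') (α + β) := by
  obtain ⟨x, hx⟩ := h
  obtain ⟨y, hy⟩ := h'
  exact ⟨x + y, fun v => (add_nonneg (hx v) (hy v)).trans (G.net_add_le d d' α β x y v)⟩

/-! ### Reduced divisors and Dhar's burning algorithm -/

/-- Vertex values that make the divisor effective away from `q`. -/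
def Feasible (q : V) (d : V → ℤ) (α : A → ℝ) (x : V → ℝ) : Prop :=
  ∀ v, v ≠ q → 0 ≤ G.net d α x v

lemma net_sub_const (d : V → ℤ) (α : A → ℝ) (x : V → ℝ) (c : ℝ) (v : V) :
    G.net d α (fun w => x w - c) v = G.net d α x v := by
  simp [net, rise]

/-- `ρ` decreases along some dart at every vertex other than `q`. -/
def IsRank (q : V) (ρ : V → ℕ) : Prop :=
  ∀ v, v ≠ q → ∃ a, G.tail a = v ∧ ρ (G.head a) < ρ v

lemma exists_len_bound : ∃ Λ : ℝ, 1 ≤ Λ ∧ (∀ a, G.len a ≤ Λ) ∧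
    ∀ s : Finset A, ∑ a ∈ s, (G.len a)⁻¹ ≤ Λ := by
  have h0 : ∀ a, 0 ≤ G.len a := fun a => (G.len_pos a).le
  have h1 : ∀ a, 0 ≤ (G.len a)⁻¹ := fun a => inv_nonneg.2 (h0 a)
  have hs : 0 ≤ ∑ a, G.len a := Finset.sum_nonneg fun a _ => h0 a
  have hs' : 0 ≤ ∑ a, (G.len a)⁻¹ := Finset.sum_nonneg fun a _ => h1 a
  refine ⟨1 + ∑ a, G.len a + ∑ a, (G.len a)⁻¹, by linarith, fun a => ?_, fun s => ?_⟩
  · have := Finset.single_le_sum (fun a _ => h0 a) (Finset.mem_univ a)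
    linarith
  · have := Finset.sum_le_sum_of_subset_of_nonneg (Finset.subset_univ s) fun a _ _ => h1 a
    linarith

/-- The total of an antisymmetric function over the darts inside a set of vertices vanishes. -/
lemma sum_antisymm_eq_zero (U : V → Prop) [DecidablePred U] (g : A → ℝ)
    (hg : ∀ a, g (G.rev a) = -g a) :
    ∑ a with U (G.tail a) ∧ U (G.head a), g a = 0 := by
  refine Finset.sum_involution (fun a _ => G.rev a) ?_ ?_ ?_ ?_
  · intro a _
    simp [hg]
  · intro a _ h0 h
    have := hg a
    rw [h] at this
    exact h0 (by linarith)
  · intro a ha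
    have := (Finset.mem_filter.1 ha).2
    exact Finset.mem_filter.2 ⟨Finset.mem_univ _, this.2, by rw [head_rev]; exact this.1⟩
  · intro a _
    exact G.rev_rev a

open Classical in
/-- A non-empty set of vertices avoiding `q` contains, for a greatest feasible vector, a vertex
with fewer chips than integral darts leaving the set. -/
lemma exists_burning_vertex {q : V} {d : V → ℤ} {α : A → ℝ} {x : V → ℝ}
    (hx : G.Feasible q d α x) (hmax : ∀ y, G.Feasible q d α y → y q = x q → y ≤ x)
    (U : Finset V) (hU : U.Nonempty) (hq : q ∉ U) :
    ∃ v ∈ U, G.net d α x v <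
      ((Finset.univ.filter fun a => G.tail a = v ∧ G.head a ∉ U ∧
        ∃ n : ℤ, G.rise α x a = n).card : ℤ) := by
  -- Otherwise `x` could be raised by a small `η` on all of `U`. Darts inside `U` keep their rise,
  -- each integral dart leaving `U` costs its tail one chip, and vertices outside `U` only gain.
  by_contra! hcon
  have hev : ∀ᶠ ε in 𝓝[>] (0 : ℝ), ∀ a,
      ⌊G.rise α x a⌋ - (if ∃ n : ℤ, G.rise α x a = n then 1 else 0)
        ≤ ⌊G.rise α x a - ε / G.len a⌋ :=
    eventually_all.2 fun a => eventually_floor_sub_div _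
  obtain ⟨η, hη, hη0 : 0 < η⟩ := (hev.and self_mem_nhdsWithin).exists
  let y : V → ℝ := fun w => x w + if w ∈ U then η else 0
  have hy : G.Feasible q d α y := by
    intro v hv
    by_cases hvU : v ∈ U
    · have h1 := hcon v hvU
      rw [Finset.card_filter] at h1
      push_cast at h1
      have h2 : ∑ a with G.tail a = v, (⌊G.rise α x a⌋ -
          (if G.head a ∉ U ∧ ∃ n : ℤ, G.rise α x a = n then 1 else 0))
            ≤ ∑ a with G.tail a = v, ⌊G.rise α y a⌋ := by
        refine Finset.sum_le_sum fun a ha => ?_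
        have ha := (Finset.mem_filter.1 ha).2
        by_cases hh : G.head a ∈ U
        · have : G.rise α y a = G.rise α x a := by
            simp [rise, y, ha, hh, hvU]
          simp [hh, this]
        · have : G.rise α y a = G.rise α x a - η / G.len a := by
            simp only [rise, y, ha, hh, hvU, if_true, if_false]
            ring
          simpa [hh, this] using hη a
      rw [Finset.sum_sub_distrib] at h2
      have h3 : ∑ a with G.tail a = v,
          (if G.head a ∉ U ∧ ∃ n : ℤ, G.rise α x a = n then (1 : ℤ) else 0) =
          ∑ a, if G.tail a = v ∧ G.head a ∉ U ∧ ∃ n : ℤ, G.rise α x a = n then 1 else 0 := by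
        rw [Finset.sum_filter]
        refine Finset.sum_congr rfl fun a _ => ?_
        by_cases h : G.tail a = v <;> simp [h]
      simp only [net] at h1 ⊢
      linarith
    · refine (hx v hv).trans ?_
      simp only [net]
      gcongr with a ha
      have ha := (Finset.mem_filter.1 ha).2
      have h1 := G.len_pos a
      simp only [rise, y, ha, hvU, if_false]
      rw [add_zero]
      gcongr
      split_ifs <;> linarith
  obtain ⟨v, hv⟩ := hU
  have := hmax y hy (by simp [y, hq]) v
  simp only [y, hv, if_true] at this
  linarith

lemma sum_rise (α : A → ℝ) (x : V → ℝ) : ∑ a, G.rise α x a = ∑ a, α a / G.len a := by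
  have h := G.sum_antisymm_eq_zero (fun _ => True)
    (fun a => (x (G.head a) - x (G.tail a)) / G.len a) fun a => by
      simp only [G.len_rev, head_rev]
      rw [show G.tail (G.rev a) = G.head a from rfl]
      ring
  simp only [and_self, Finset.filter_true] at h
  simp only [rise, add_div, Finset.sum_add_distrib]
  rw [h, zero_add]

variable [Fintype V]

/-- Values decaying fast enough with `ρ` work: at `v ≠ q` the inflow from one neighbour of smaller
`ρ` beats the outflow along all darts at `v`, the shifts, the rounding and the debt of `d`. -/
lemma exists_feasible (q : V) (ρ : V → ℕ) (hρ : G.IsRank q ρ) (d : V → ℤ) (α : A → ℝ) :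
    ∃ x, G.Feasible q d α x := by
  classical
  obtain ⟨Λ, hΛ1, hΛ, hΛs⟩ := G.exists_len_bound
  -- With this ratio the outflow `x v * Λ` uses at most half of the inflow `x (G.head a₀) * Λ⁻¹`;
  -- the size of `M` makes the other half at least `K`.
  set c : ℝ := 1 / (2 * Λ ^ 2) with hc
  have hc0 : 0 < c := by positivity
  have hc1 : c ≤ 1 := by
    rw [hc, div_le_one (by positivity)]
    nlinarith
  set K : ℝ := ∑ a, (|α a| / G.len a + 1) + ∑ v, |(d v : ℝ)| with hK
  have hKa : ∀ a, 0 ≤ |α a| / G.len a + 1 := fun a => by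
    have := G.len_pos a
    positivity
  have hK0 : 0 ≤ K := add_nonneg (Finset.sum_nonneg fun a _ => hKa a)
    (Finset.sum_nonneg fun v _ => abs_nonneg _)
  set N : ℕ := Finset.univ.sup ρ
  set M : ℝ := 2 * Λ * K / c ^ N with hM
  have hM0 : 0 ≤ M := by positivity
  set x : V → ℝ := fun v => M * c ^ ρ v with hx
  have hx0 : ∀ v, 0 ≤ x v := fun v => by positivity
  refine ⟨x, fun v hv => ?_⟩
  obtain ⟨a₀, ha₀, hlt⟩ := hρ v hv
  have h1 : ∀ a, G.tail a = v →
      x (G.head a) * (G.len a)⁻¹ - x v * (G.len a)⁻¹ - (|α a| / G.len a + 1)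
        ≤ (⌊G.rise α x a⌋ : ℝ) := by
    intro a ha
    have h2 := Int.sub_one_lt_floor (G.rise α x a)
    have h3 : -(|α a| / G.len a) ≤ α a / G.len a := by
      rw [← neg_div]
      exact div_le_div_of_nonneg_right (neg_abs_le _) (G.len_pos a).le
    have h4 : G.rise α x a = x (G.head a) * (G.len a)⁻¹ - x v * (G.len a)⁻¹ + α a / G.len a := by
      rw [rise, ha]
      ring
    linarith
  have h2 : ∑ a with G.tail a = v,
      (x (G.head a) * (G.len a)⁻¹ - x v * (G.len a)⁻¹ - (|α a| / G.len a + 1))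
        ≤ ∑ a with G.tail a = v, (⌊G.rise α x a⌋ : ℝ) :=
    Finset.sum_le_sum fun a ha => h1 a (Finset.mem_filter.1 ha).2
  rw [Finset.sum_sub_distrib, Finset.sum_sub_distrib, ← Finset.mul_sum] at h2
  have h3 : x (G.head a₀) * (G.len a₀)⁻¹ ≤ ∑ a with G.tail a = v, x (G.head a) * (G.len a)⁻¹ :=
    Finset.single_le_sum (f := fun a => x (G.head a) * (G.len a)⁻¹)
      (fun a _ => mul_nonneg (hx0 _) (inv_nonneg.2 (G.len_pos a).le))
      (Finset.mem_filter.2 ⟨Finset.mem_univ _, ha₀⟩)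
  have h4 : x v * ∑ a with G.tail a = v, (G.len a)⁻¹ ≤ x v * Λ :=
    mul_le_mul_of_nonneg_left (hΛs _) (hx0 v)
  have h5 : ∑ a with G.tail a = v, (|α a| / G.len a + 1) ≤ ∑ a, (|α a| / G.len a + 1) :=
    Finset.sum_le_sum_of_subset_of_nonneg (Finset.subset_univ _) fun a _ _ => hKa a
  have h6 : -(d v : ℝ) ≤ ∑ v, |(d v : ℝ)| :=
    (neg_le_abs _).trans (Finset.single_le_sum (f := fun v => |(d v : ℝ)|)
      (fun _ _ => abs_nonneg _) (Finset.mem_univ v))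
  have h7 : x (G.head a₀) * Λ⁻¹ ≤ x (G.head a₀) * (G.len a₀)⁻¹ :=
    mul_le_mul_of_nonneg_left (inv_anti₀ (G.len_pos a₀) (hΛ a₀)) (hx0 _)
  have h8 : x v ≤ c * x (G.head a₀) := by
    have : c ^ ρ v ≤ c ^ (ρ (G.head a₀) + 1) := pow_le_pow_of_le_one hc0.le hc1 hlt
    calc M * c ^ ρ v ≤ M * c ^ (ρ (G.head a₀) + 1) := mul_le_mul_of_nonneg_left this hM0
      _ = c * (M * c ^ ρ (G.head a₀)) := by ring
  have h9 : 2 * Λ * K ≤ x (G.head a₀) := by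
    have : c ^ N ≤ c ^ ρ (G.head a₀) :=
      pow_le_pow_of_le_one hc0.le hc1 (Finset.le_sup (f := ρ) (Finset.mem_univ _))
    calc 2 * Λ * K = M * c ^ N := by rw [hM]; field_simp
      _ ≤ M * c ^ ρ (G.head a₀) := mul_le_mul_of_nonneg_left this hM0
  have h10 : x v * Λ ≤ x (G.head a₀) * Λ⁻¹ / 2 := by
    calc x v * Λ ≤ c * x (G.head a₀) * Λ := mul_le_mul_of_nonneg_right h8 (by linarith)
      _ = x (G.head a₀) * Λ⁻¹ / 2 := by rw [hc]; field_simp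
  have h11 : K ≤ x (G.head a₀) * Λ⁻¹ / 2 := by
    have : K = 2 * Λ * K * Λ⁻¹ / 2 := by field_simp
    rw [this]
    gcongr
  have : (0 : ℝ) ≤ (G.net d α x v : ℝ) := by
    rw [net]
    push_cast
    linarith
  exact_mod_cast this

/-- Sum the coefficients over the superlevel set of `x (G.tail a₀)`. Inner darts cancel and every
dart leaving the set descends, so one steep descent would make the total negative. The maximum with
`0` ensures that the set misses `q`. -/
lemma exists_drop_bound (q : V) (d : V → ℤ) (α : A → ℝ) : ∃ C : ℝ, 0 ≤ C ∧
    ∀ x, G.Feasible q d α x → x q = 0 → ∀ a, x (G.tail a) ≤ max (x (G.head a)) 0 + C := by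
  classical
  obtain ⟨Λ, hΛ1, hΛ, -⟩ := G.exists_len_bound
  set K : ℝ := ∑ v, |(d v : ℝ)| + ∑ a, |α a| / G.len a with hK
  have hKa : ∀ a, 0 ≤ |α a| / G.len a := fun a => by
    have := G.len_pos a
    positivity
  have hK0 : 0 ≤ K := add_nonneg (Finset.sum_nonneg fun v _ => abs_nonneg _)
    (Finset.sum_nonneg fun a _ => hKa a)
  refine ⟨K * Λ, by positivity, fun x hx hq a₀ => ?_⟩
  by_contra! hcon
  have hKΛ : 0 ≤ K * Λ := by positivity
  have hlt : x (G.head a₀) < x (G.tail a₀) := by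
    have := le_max_left (x (G.head a₀)) 0
    linarith
  have hpos : 0 < x (G.tail a₀) := by
    have := le_max_right (x (G.head a₀)) 0
    linarith
  let U : V → Prop := fun w => x (G.tail a₀) ≤ x w
  have hnet : 0 ≤ ∑ w with U w, G.net d α x w := by
    refine Finset.sum_nonneg fun w hw => hx w ?_
    rintro rfl
    have := (Finset.mem_filter.1 hw).2
    simp only [U, hq] at this
    linarith
  have hfib : ∑ w with U w, ∑ a with G.tail a = w, ⌊G.rise α x a⌋
      = ∑ a with U (G.tail a), ⌊G.rise α x a⌋ := by
    rw [← Finset.sum_fiberwise_of_maps_to (s := Finset.univ.filter fun a => U (G.tail a))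
      (t := Finset.univ.filter U) (g := G.tail) (by simp)]
    refine Finset.sum_congr rfl fun w hw => ?_
    congr 1
    ext a
    have := (Finset.mem_filter.1 hw).2
    simp only [Finset.mem_filter, Finset.mem_univ, true_and]
    exact ⟨fun h => ⟨h ▸ this, h⟩, fun h => h.2⟩
  let g : A → ℝ := fun a => (x (G.head a) - x (G.tail a)) / G.len a
  have h1 : (∑ a with U (G.tail a), (⌊G.rise α x a⌋ : ℝ))
      ≤ ∑ a with U (G.tail a), (g a + |α a| / G.len a) := by
    refine Finset.sum_le_sum fun a _ => (Int.floor_le _).trans ?_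
    rw [rise, add_div]
    have := G.len_pos a
    have := le_abs_self (α a)
    simp only [g]
    gcongr
  have h2 : ∑ a with U (G.tail a), g a = ∑ a with U (G.tail a) ∧ ¬ U (G.head a), g a := by
    have h0 := G.sum_antisymm_eq_zero U g fun a => by
      simp only [g, G.len_rev, head_rev]
      rw [show G.tail (G.rev a) = G.head a from rfl]
      ring
    rw [← Finset.sum_filter_add_sum_filter_not _ (fun a => U (G.head a)), Finset.filter_filter,
      Finset.filter_filter, h0, zero_add]
  have h3 : ∑ a with U (G.tail a) ∧ ¬ U (G.head a), g a ≤ g a₀ := by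
    have hmem : a₀ ∈ Finset.univ.filter fun a => U (G.tail a) ∧ ¬ U (G.head a) := by
      simp only [Finset.mem_filter, Finset.mem_univ, true_and, U]
      exact ⟨le_rfl, not_le.2 hlt⟩
    have := Finset.single_le_sum (f := fun a => -g a) (fun a ha => ?_) hmem
    · rw [Finset.sum_neg_distrib] at this
      linarith
    · have ha := (Finset.mem_filter.1 ha).2
      simp only [U, not_le] at ha
      rw [Left.nonneg_neg_iff]
      exact div_nonpos_of_nonpos_of_nonneg (by linarith [ha.1, ha.2]) (G.len_pos a).le
  have h4 : ∑ w with U w, (d w : ℝ) ≤ ∑ w, |(d w : ℝ)| :=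
    (Finset.sum_le_sum fun w _ => le_abs_self _).trans
      (Finset.sum_le_sum_of_subset_of_nonneg (Finset.subset_univ _) fun w _ _ => abs_nonneg _)
  have h5 : ∑ a with U (G.tail a), |α a| / G.len a ≤ ∑ a, |α a| / G.len a :=
    Finset.sum_le_sum_of_subset_of_nonneg (Finset.subset_univ _) fun a _ _ => hKa a
  have h6 : (0 : ℝ) ≤ ∑ w with U w, (d w : ℝ) + ∑ a with U (G.tail a), (⌊G.rise α x a⌋ : ℝ) := by
    simp only [net, Finset.sum_add_distrib, hfib] at hnet
    exact_mod_cast hnet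
  rw [Finset.sum_add_distrib] at h1
  have h7 : (x (G.tail a₀) - x (G.head a₀)) / G.len a₀ ≤ K := by
    have : (x (G.tail a₀) - x (G.head a₀)) / G.len a₀ = -g a₀ := by
      simp only [g]; ring
    linarith
  rw [div_le_iff₀ (G.len_pos a₀)] at h7
  have h8 : K * G.len a₀ ≤ K * Λ := mul_le_mul_of_nonneg_left (hΛ a₀) hK0
  have := le_max_left (x (G.head a₀)) 0
  linarith

/-- Each step down `ρ` towards `q` accounts for at most `C`. -/
lemma feasible_bounded (q : V) (ρ : V → ℕ) (hρ : G.IsRank q ρ) (d : V → ℤ) (α : A → ℝ) :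
    ∃ C : ℝ, ∀ x, G.Feasible q d α x → x q = 0 → ∀ v, x v ≤ C * ρ v := by
  obtain ⟨C, hC, h⟩ := G.exists_drop_bound q d α
  refine ⟨C, fun x hx hq v => ?_⟩
  induction hn : ρ v using Nat.strong_induction_on generalizing v with
  | _ n ih =>
    by_cases hv : v = q
    · rw [hv, hq]
      positivity
    · obtain ⟨a, rfl, hlt⟩ := hρ v hv
      have h1 := ih _ (hn ▸ hlt) (G.head a) rfl
      have h2 := h x hx hq a
      have h3 : (ρ (G.head a) : ℝ) + 1 ≤ n := by
        rw [← hn]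
        exact_mod_cast hlt
      have h4 : max (x (G.head a)) 0 ≤ C * ρ (G.head a) := max_le h1 (by positivity)
      nlinarith

/-- There is a greatest feasible vector with given value at `q`. -/
theorem exists_greatest_feasible (q : V) (ρ : V → ℕ) (hρ : G.IsRank q ρ) (d : V → ℤ)
    (α : A → ℝ) : ∃ x, G.Feasible q d α x ∧ ∀ y, G.Feasible q d α y → y q = x q → y ≤ x := by
  classical
  obtain ⟨C, hC⟩ := G.feasible_bounded q ρ hρ d α
  let X : Set (V → ℝ) := {x | G.Feasible q d α x ∧ x q = 0}
  have hne : X.Nonempty := by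
    obtain ⟨x, hx⟩ := G.exists_feasible q ρ hρ d α
    exact ⟨fun w => x w - x q, fun v hv => by rw [net_sub_const]; exact hx v hv, sub_self _⟩
  have hbdd : ∀ v, BddAbove ((fun x : V → ℝ => x v) '' X) := fun v =>
    ⟨C * ρ v, by rintro _ ⟨x, hx, rfl⟩; exact hC x hx.1 hx.2 v⟩
  let z : V → ℝ := fun v => sSup ((fun x : V → ℝ => x v) '' X)
  have hle : ∀ x ∈ X, x ≤ z := fun x hx v => le_csSup (hbdd v) ⟨x, hx, rfl⟩
  have hzq : z q = 0 := by
    have : (fun x : V → ℝ => x q) '' X = {0} := by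
      ext t
      constructor
      · rintro ⟨x, hx, rfl⟩
        exact hx.2
      · rintro rfl
        obtain ⟨x, hx⟩ := hne
        exact ⟨x, hx, hx.2⟩
    simp only [z, this, csSup_singleton]
  refine ⟨z, fun v hv => ?_, fun y hy hyq => hle y ⟨hy, hyq.trans hzq⟩⟩
  -- At `v`, the supremum `z` is approached within `η` by a feasible `x ≤ z`. The rises of `x` at
  -- `v` exceed those of `z` by at most `η / len`, which the floors do not see.
  have hev : ∀ᶠ ε in 𝓝[>] (0 : ℝ), ∀ a,
      ⌊G.rise α z a + ε / G.len a⌋ ≤ ⌊G.rise α z a⌋ :=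
    eventually_all.2 fun a => eventually_floor_add_div _ _
  obtain ⟨η, hη, hη0⟩ := (hev.and self_mem_nhdsWithin).exists
  obtain ⟨_, ⟨x, hx, rfl⟩, hxv⟩ := exists_lt_of_lt_csSup (hne.image (fun x : V → ℝ => x v))
    (sub_lt_self (z v) hη0)
  refine (hx.1 v hv).trans ?_
  simp only [net]
  refine add_le_add_right (Finset.sum_le_sum fun a ha => ?_) _
  refine le_trans (Int.floor_le_floor ?_) (hη a)
  have ha := (Finset.mem_filter.1 ha).2
  have := hle x hx (G.head a)
  rw [rise, rise, ← add_div, ha]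
  have := G.len_pos a
  simp only at hxv
  refine div_le_div_of_nonneg_right ?_ this.le
  linarith

open Classical in
/-- A divisor that is not effective is dominated by the divisor of an acyclic orientation. -/
theorem exists_order_of_not_effective (q : V) (ρ : V → ℕ) (hρ : G.IsRank q ρ) (d : V → ℤ)
    (α : A → ℝ) (hd : ¬ G.Effective d α) :
    ∃ (x : V → ℝ) (h : V → ℕ), Function.Injective h ∧ G.Feasible q d α x ∧ ∀ v, G.net d α x v <
      ((Finset.univ.filter fun a => G.tail a = v ∧ h (G.head a) < h v ∧
        ∃ n : ℤ, G.rise α x a = n).card : ℤ) := by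
  obtain ⟨x, hx, hmax⟩ := G.exists_greatest_feasible q ρ hρ d α
  have hq : G.net d α x q < 0 := by
    by_contra! h
    exact hd ⟨x, fun v => if hv : v = q then hv ▸ h else hx v hv⟩
  -- `B` is the burnt set and `h` the time of burning, counted from `0` on `B`; the induction is on
  -- the number of unburnt vertices. Starting with `B = {q}` makes `h` injective everywhere.
  have key : ∀ (n : ℕ) (B : Finset V), q ∈ B → Bᶜ.card = n →
      ∃ h : V → ℕ, (∀ v ∈ B, h v = 0) ∧ (∀ v ∉ B, 0 < h v) ∧ Set.InjOn h (Bᶜ : Finset V) ∧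
        ∀ v ∉ B, G.net d α x v <
          ((Finset.univ.filter fun a => G.tail a = v ∧ h (G.head a) < h v ∧
            ∃ n : ℤ, G.rise α x a = n).card : ℤ) := by
    intro n
    induction n with
    | zero =>
      intro B _ hB
      have hB' : ∀ v, v ∈ B := by
        simpa [Finset.eq_univ_iff_forall] using hB
      exact ⟨fun _ => 0, fun _ _ => rfl, fun v hv => absurd (hB' v) hv,
        fun v hv => absurd (hB' v) (by simpa using hv), fun v hv => absurd (hB' v) hv⟩
    | succ n ih =>
      intro B hqB hB
      obtain ⟨v, hvU, hv⟩ := G.exists_burning_vertex hx hmax Bᶜ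
        (Finset.card_pos.1 (by omega)) (by simpa using hqB)
      have hvB : v ∉ B := by simpa using hvU
      obtain ⟨h, h0, hpos, hinj, hnet⟩ := ih (insert v B) (Finset.mem_insert_of_mem hqB) (by
        rw [Finset.card_compl] at hB ⊢
        rw [Finset.card_insert_of_notMem hvB]
        omega)
      -- The recursive call regards `v` as burnt at time `0`. Delaying everything outside `B` by one
      -- puts `v` alone at time `1`.
      let h' : V → ℕ := fun w => if w ∈ B then 0 else h w + 1
      have hB' : ∀ w ∈ B, h' w = 0 := fun w hw => by simp [h', hw]
      have hnB : ∀ w ∉ B, h' w = h w + 1 := fun w hw => by simp [h', hw]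
      refine ⟨h', hB', fun w hw => by simp [h', hw], ?_, ?_⟩
      · intro w hw w' hw' heq
        have hw : w ∉ B := by simpa using hw
        have hw' : w' ∉ B := by simpa using hw'
        rw [hnB w hw, hnB w' hw', Nat.add_right_cancel_iff] at heq
        by_cases h1 : w = v <;> by_cases h2 : w' = v
        · rw [h1, h2]
        · have := hpos w' (by simp [h2, hw'])
          rw [← heq, h0 w (by simp [h1])] at this
          omega
        · have := hpos w (by simp [h1, hw])
          rw [heq, h0 w' (by simp [h2])] at this
          omega
        · exact hinj (by simp [h1, hw]) (by simp [h2, hw']) heq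
      · intro w hw
        by_cases hwv : w = v
        · subst hwv
          refine hv.trans_le ?_
          norm_cast
          refine Finset.card_le_card fun a ha => ?_
          simp only [Finset.mem_filter, Finset.mem_univ, true_and, Finset.mem_compl,
            not_not] at ha ⊢
          exact ⟨ha.1, by rw [hB' _ ha.2.1, hnB _ hw]; omega, ha.2.2⟩
        · refine (hnet w (by simp [hwv, hw])).trans_le ?_
          norm_cast
          refine Finset.card_le_card fun a ha => ?_
          simp only [Finset.mem_filter, Finset.mem_univ, true_and] at ha ⊢
          refine ⟨ha.1, ?_, ha.2.2⟩
          rw [hnB _ hw]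
          simp only [h']
          split_ifs <;> omega
  obtain ⟨h, h0, hpos, hinj, hnet⟩ := key _ {q} (by simp) rfl
  refine ⟨x, h, ?_, hx, ?_⟩
  · intro v w hvw
    by_cases h1 : v = q <;> by_cases h2 : w = q
    · rw [h1, h2]
    · have := hpos w (by simp [h2])
      rw [← hvw, h0 v (by simp [h1])] at this
      omega
    · have := hpos v (by simp [h1])
      rw [hvw, h0 w (by simp [h2])] at this
      omega
    · exact hinj (by simpa using h1) (by simpa using h2) hvw
  · intro v
    by_cases hv : v = q
    · rw [hv]
      exact hq.trans_le (by positivity)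
    · exact hnet v (by simp [hv])

/-! ### Acyclic orientations and divisors of degree zero -/

open Classical in
/-- The divisor of an acyclic orientation is not effective. -/
theorem not_effective_of_order [Nonempty V] {β : Type*} [LinearOrder β] (h : V → β) {d : V → ℤ}
    {α : A → ℝ} (hα : ∀ a, α a < G.len a)
    (hd : ∀ v, d v < ((Finset.univ.filter fun a => G.tail a = v ∧
      (α a < 0 ∨ α a ≤ 0 ∧ h (G.head a) < h v)).card : ℤ)) :
    ¬ G.Effective d α := by
  rintro ⟨x, hx⟩
  -- At a maximum of `x` every rise is below one, so no floor is positive. At the `h`-least maximum,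
  -- heads with smaller `h` have strictly smaller values, so every counted dart contributes at most
  -- `-1`.
  obtain ⟨w, -, hw⟩ := Finset.exists_max_image (Finset.univ : Finset V) x Finset.univ_nonempty
  obtain ⟨v, hv, hvh⟩ := Finset.exists_min_image (Finset.univ.filter fun v => x v = x w) h
    ⟨w, by simp⟩
  have hvw : x v = x w := (Finset.mem_filter.1 hv).2
  have hle : ∀ u, x u ≤ x v := fun u => hvw ▸ hw u (Finset.mem_univ u)
  have h1 : ∑ a with G.tail a = v, ⌊G.rise α x a⌋ ≤ ∑ a with G.tail a = v,
      -(if α a < 0 ∨ α a ≤ 0 ∧ h (G.head a) < h v then (1 : ℤ) else 0) := by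
    refine Finset.sum_le_sum fun a ha => ?_
    have ha := (Finset.mem_filter.1 ha).2
    have hlen := G.len_pos a
    have hxa := hle (G.head a)
    split_ifs with hc
    · have : G.rise α x a < 0 := by
        rw [rise, ha]
        refine div_neg_of_neg_of_pos ?_ hlen
        rcases hc with hc | ⟨hc, hh⟩
        · linarith
        · have hne : x (G.head a) ≠ x v := fun heq =>
            (hvh (G.head a) (by simp [heq, hvw])).not_gt hh
          have := lt_of_le_of_ne hxa hne
          linarith
      have := Int.floor_lt.2 (show G.rise α x a < ((0 : ℤ) : ℝ) by simpa using this)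
      omega
    · have : G.rise α x a < 1 := by
        rw [rise, ha, div_lt_one hlen]
        linarith [hα a]
      have := Int.floor_lt.2 (show G.rise α x a < ((1 : ℤ) : ℝ) by simpa using this)
      omega
  rw [Finset.sum_neg_distrib, ← Finset.sum_filter, Finset.filter_filter] at h1
  have h2 := hd v
  have h3 := hx v
  rw [Finset.card_eq_sum_ones] at h2
  push_cast at h2
  rw [net] at h3
  linarith

lemma sum_net (d : V → ℤ) (α : A → ℝ) (x : V → ℝ) :
    ∑ v, G.net d α x v = ∑ v, d v + ∑ a, ⌊G.rise α x a⌋ := by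
  classical
  simp only [net, Finset.sum_add_distrib]
  congr 1
  convert Finset.sum_fiberwise Finset.univ G.tail fun a => ⌊G.rise α x a⌋

lemma Effective.degree_nonneg {d : V → ℤ} {α : A → ℝ} (h : G.Effective d α) :
    0 ≤ ∑ v, (d v : ℝ) + ∑ a, α a / G.len a := by
  obtain ⟨x, hx⟩ := h
  have h1 : 0 ≤ ∑ v, G.net d α x v := Finset.sum_nonneg fun v _ => hx v
  rw [sum_net] at h1
  have h2 : (0 : ℝ) ≤ ∑ v, (d v : ℝ) + ∑ a, (⌊G.rise α x a⌋ : ℝ) := by exact_mod_cast h1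
  have h3 : ∑ a, (⌊G.rise α x a⌋ : ℝ) ≤ ∑ a, G.rise α x a :=
    Finset.sum_le_sum fun a _ => Int.floor_le _
  rw [sum_rise] at h3
  linarith

/-- An effective divisor of degree zero is principal. -/
lemma Effective.neg_of_degree_eq_zero {d : V → ℤ} {α : A → ℝ} (h : G.Effective d α)
    (h0 : ∑ v, (d v : ℝ) + ∑ a, α a / G.len a = 0) : G.Effective (-d) (-α) := by
  classical
  obtain ⟨x, hx⟩ := h
  have h1 : (∑ v, (G.net d α x v : ℝ)) = ∑ v, (d v : ℝ) + ∑ a, (⌊G.rise α x a⌋ : ℝ) := by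
    exact_mod_cast G.sum_net d α x
  have hx' : ∀ v, (0 : ℝ) ≤ G.net d α x v := fun v => by exact_mod_cast hx v
  have h2 : 0 ≤ ∑ v, (G.net d α x v : ℝ) := Finset.sum_nonneg fun v _ => hx' v
  have h3 : ∑ a, (⌊G.rise α x a⌋ : ℝ) ≤ ∑ a, G.rise α x a :=
    Finset.sum_le_sum fun a _ => Int.floor_le _
  have h4 := G.sum_rise α x
  -- Non-negative coefficients with total at most the degree zero leave no slack: all coefficients
  -- vanish and all rises are integers, so negating `x` negates everything.
  have h5 : ∀ v, G.net d α x v = 0 := fun v => by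
    have := (Finset.sum_eq_zero_iff_of_nonneg fun v _ => hx' v).1
      (by linarith : ∑ v, (G.net d α x v : ℝ) = 0) v (Finset.mem_univ v)
    exact_mod_cast this
  have h6 : ∀ a, (⌊G.rise α x a⌋ : ℝ) = G.rise α x a := fun a =>
    (Finset.sum_eq_sum_iff_of_le fun a _ => Int.floor_le _).1
      (by linarith : ∑ a, (⌊G.rise α x a⌋ : ℝ) = ∑ a, G.rise α x a) a (Finset.mem_univ a)
  refine ⟨-x, fun v => ?_⟩
  have h7 : ∀ a, ⌊G.rise (-α) (-x) a⌋ = -⌊G.rise α x a⌋ := fun a => by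
    have : G.rise (-α) (-x) a = ((-⌊G.rise α x a⌋ : ℤ) : ℝ) := by
      push_cast
      rw [h6]
      simp only [rise, Pi.neg_apply]
      ring
    rw [this, Int.floor_intCast]
  have h8 := h5 v
  simp only [net, h7, Finset.sum_neg_distrib, Pi.neg_apply] at h8 ⊢
  linarith

end DartGraph

/-! ### Divisors on the curve as vertex parts and edge shifts -/

namespace TropicalCurve

variable {V E : Type*} (Γ : TropicalCurve V E)

open Classical in
/-- The length of an edge, with infinite lengths replaced by `1`. -/
noncomputable def len (e : E) : ℝ := if Γ.length e = ⊤ then 1 else (Γ.length e).toReal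

lemma coe_len {e : E} (h : Γ.length e ≠ ⊤) : (Γ.len e : EReal) = Γ.length e := by
  rw [len, if_neg h]
  exact EReal.coe_toReal h (Γ.length_pos e).ne_bot

lemma len_pos (e : E) : 0 < Γ.len e := by
  by_cases h : Γ.length e = ⊤
  · simp [len, h]
  · have := Γ.length_pos e
    rw [← Γ.coe_len h] at this
    exact_mod_cast this

lemma coe_len_le (e : E) : (Γ.len e : EReal) ≤ Γ.length e := by
  by_cases h : Γ.length e = ⊤
  · simp [h]
  · exact (Γ.coe_len h).le

/-- The graph of the curve, as a graph with darts. -/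
noncomputable def darts : DartGraph V (E ⊕ E) where
  tail := Sum.elim Γ.src Γ.tgt
  rev := Sum.swap
  len := Sum.elim Γ.len Γ.len
  rev_rev := Sum.swap_swap
  len_pos := by rintro (e | e) <;> exact Γ.len_pos e
  len_rev := by rintro (e | e) <;> rfl

variable {Γ}

/-- The parameter of an internal point of an edge. -/
def Point.pos : Γ.Point → ℝ
  | .vertex _ => 0
  | .interior _ t _ _ => t

open Classical in
/-- The part of a divisor on the interior of an edge. -/
noncomputable def edgePart (e : E) : Γ.Divisor →+ (ℝ →₀ ℤ) where
  toFun D := Finsupp.onFinset (D.support.image Point.pos)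
    (fun s => if h : 0 < s ∧ (s : EReal) < Γ.length e then D (.interior e s h.1 h.2) else 0) (by
      intro s hs
      by_cases h : 0 < s ∧ (s : EReal) < Γ.length e
      · rw [dif_pos h] at hs
        exact Finset.mem_image.2 ⟨_, Finsupp.mem_support_iff.2 hs, rfl⟩
      · exact absurd (dif_neg h) hs)
  map_zero' := by ext s; simp
  map_add' D D' := by
    ext s
    simp only [Finsupp.onFinset_apply, Finsupp.add_apply]
    split_ifs <;> simp

open Classical in
lemma edgePart_apply (e : E) (D : Γ.Divisor) (s : ℝ) : edgePart e D s =
    if h : 0 < s ∧ (s : EReal) < Γ.length e then D (.interior e s h.1 h.2) else 0 := rfl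

lemma edgePart_apply_of_mem {e : E} (D : Γ.Divisor) {s : ℝ} (h0 : 0 < s)
    (h1 : (s : EReal) < Γ.length e) : edgePart e D s = D (.interior e s h0 h1) := by
  rw [edgePart_apply, dif_pos ⟨h0, h1⟩]

lemma mem_of_mem_support {e : E} {D : Γ.Divisor} {s : ℝ} (h : s ∈ (edgePart e D).support) :
    0 < s ∧ (s : EReal) < Γ.length e := by
  by_contra h'
  rw [Finsupp.mem_support_iff, edgePart_apply, dif_neg h'] at h
  exact h rfl

lemma edgePart_nonneg {D : Γ.Divisor} (h : 0 ≤ D) (e : E) (s : ℝ) : 0 ≤ edgePart e D s := by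
  rw [edgePart_apply]
  split_ifs with hs
  · exact h _
  · exact le_rfl

lemma edgePart_single_vertex (e : E) (v : V) (n : ℤ) :
    edgePart e (Finsupp.single (Point.vertex v : Γ.Point) n) = 0 := by
  ext s
  rw [edgePart_apply]
  split_ifs <;> simp

lemma edgePart_single_interior (e : E) (s : ℝ) (h0 : 0 < s) (h1 : (s : EReal) < Γ.length e)
    (n : ℤ) : edgePart e (Finsupp.single (Point.interior e s h0 h1 : Γ.Point) n) =
      Finsupp.single s n := by
  classical
  ext t
  rw [edgePart_apply]
  by_cases hts : s = t
  · subst hts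
    simp [h0, h1]
  · split_ifs <;> simp [hts]

lemma edgePart_single_interior_of_ne {e e' : E} (hne : e' ≠ e) (s : ℝ) (h0 : 0 < s)
    (h1 : (s : EReal) < Γ.length e') (n : ℤ) :
    edgePart e (Finsupp.single (Point.interior e' s h0 h1 : Γ.Point) n) = 0 := by
  classical
  ext t
  rw [edgePart_apply]
  split_ifs <;> simp [hne]

/-- The degree of the part of a divisor on the interior of an edge. -/
noncomputable def edgeDeg (e : E) : Γ.Divisor →+ ℤ :=
  (Finsupp.liftAddHom fun _ => AddMonoidHom.id ℤ).comp (edgePart e)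

/-- The sum of a function of the parameter over a divisor on the interior of an edge. -/
noncomputable def edgeSum (e : E) (w : ℝ → ℝ) : Γ.Divisor →+ ℝ :=
  (Finsupp.liftAddHom fun s => (AddMonoidHom.mulRight (w s)).comp (Int.castAddHom ℝ)).comp
    (edgePart e)

lemma edgeDeg_apply (e : E) (D : Γ.Divisor) :
    edgeDeg e D = (edgePart e D).sum fun _ k => k := rfl

lemma edgeSum_apply (e : E) (w : ℝ → ℝ) (D : Γ.Divisor) :
    edgeSum e w D = (edgePart e D).sum fun s k => k * w s := rfl

open Classical in
/-- The weights defining the shift of a dart. -/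
noncomputable def weight (Γ : TropicalCurve V E) : E ⊕ E → ℝ → ℝ
  -- On an infinite edge a chip is weighted as if it sat at the far end of an edge of length one,
  -- that is, at the unbounded end.
  | .inl e, s => if Γ.length e = ⊤ then 0 else Γ.len e - s
  | .inr e, s => if Γ.length e = ⊤ then 1 else s

/-- The edge shifts determined by a divisor. -/
noncomputable def shift (D : Γ.Divisor) (a : E ⊕ E) : ℝ :=
  edgeSum (a.elim id id) (Γ.weight a) D

/-- The restriction of a divisor to the vertices. -/
def vertexPart (D : Γ.Divisor) (v : V) : ℤ := D (.vertex v)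

lemma shift_add (D D' : Γ.Divisor) : shift (D + D') = shift D + shift D' := by
  ext a; simp [shift]

lemma shift_neg (D : Γ.Divisor) : shift (-D) = -shift D := by
  ext a; simp [shift]

lemma shift_sub (D D' : Γ.Divisor) : shift (D - D') = shift D - shift D' := by
  ext a; simp [shift]

lemma vertexPart_add (D D' : Γ.Divisor) : vertexPart (D + D') = vertexPart D + vertexPart D' := rfl

lemma vertexPart_neg (D : Γ.Divisor) : vertexPart (-D) = -vertexPart D := rfl

lemma vertexPart_sub (D D' : Γ.Divisor) : vertexPart (D - D') = vertexPart D - vertexPart D' := rfl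

lemma weight_inl_add_inr (e : E) (s : ℝ) :
    Γ.weight (.inl e) s + Γ.weight (.inr e) s = Γ.len e := by
  by_cases h : Γ.length e = ⊤ <;> simp [weight, h, len]

lemma weight_nonneg {a : E ⊕ E} {s : ℝ} (h0 : 0 < s)
    (h1 : (s : EReal) < Γ.length (a.elim id id)) : 0 ≤ Γ.weight a s := by
  rcases a with e | e
  · by_cases h : Γ.length e = ⊤
    · simp [weight, h]
    · simp only [Sum.elim_inl, id, ← Γ.coe_len h] at h1
      have : s < Γ.len e := by exact_mod_cast h1
      simp only [weight, h, if_false]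
      linarith
  · simp only [weight]
    split_ifs <;> linarith

lemma shift_nonneg {D : Γ.Divisor} (hD : 0 ≤ D) (a : E ⊕ E) : 0 ≤ shift D a := by
  rw [shift, edgeSum_apply]
  refine Finset.sum_nonneg fun s hs => mul_nonneg ?_ ?_
  · exact_mod_cast edgePart_nonneg hD _ s
  · have := mem_of_mem_support hs
    exact weight_nonneg this.1 this.2

lemma shift_inl_add_inr (D : Γ.Divisor) (e : E) :
    shift D (.inl e) + shift D (.inr e) = edgeDeg e D * Γ.len e := by
  simp only [shift, edgeSum_apply, edgeDeg_apply, Finsupp.sum, Sum.elim_inl, Sum.elim_inr, id]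
  rw [← Finset.sum_add_distrib]
  push_cast
  rw [Finset.sum_mul]
  refine Finset.sum_congr rfl fun s _ => ?_
  rw [← weight_inl_add_inr e s]
  ring

lemma deg_eq_liftAddHom (D : Γ.Divisor) :
    deg D = (Finsupp.liftAddHom fun _ => AddMonoidHom.id ℤ) D := rfl

lemma deg_add (D D' : Γ.Divisor) : deg (D + D') = deg D + deg D' := by
  simp only [deg_eq_liftAddHom, map_add]

lemma deg_sub (D D' : Γ.Divisor) : deg (D - D') = deg D - deg D' := by
  simp only [deg_eq_liftAddHom, map_sub]

section Finite

variable [Fintype V] [Fintype E]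

lemma deg_eq_sum (D : Γ.Divisor) : deg D = ∑ v, vertexPart D v + ∑ e, edgeDeg e D := by
  classical
  induction D using Finsupp.induction_linear with
  | zero => simp [deg, vertexPart]
  | add D D' h h' =>
    rw [deg_add, h, h', vertexPart_add]
    simp only [map_add, Pi.add_apply, Finset.sum_add_distrib]
    ring
  | single p n =>
    rcases p with v | ⟨e, t, h0, h1⟩
    · simp [deg, edgeDeg_apply, edgePart_single_vertex, vertexPart, Finsupp.single_apply]
    · rw [Finset.sum_eq_single e]
      · simp [deg, edgeDeg_apply, edgePart_single_interior, vertexPart]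
      · intro e' _ hne
        rw [edgeDeg_apply, edgePart_single_interior_of_ne hne.symm]
        simp
      · simp

/-- The divisor with given vertex part and one point of given multiplicity on every edge. -/
noncomputable def build (d : V → ℤ) (w : E → ℤ) (p : E → ℝ)
    (hp : ∀ e, 0 < p e ∧ (p e : EReal) < Γ.length e) : Γ.Divisor :=
  ∑ v, Finsupp.single (.vertex v) (d v) +
    ∑ e, Finsupp.single (.interior e (p e) (hp e).1 (hp e).2) (w e)

variable (d : V → ℤ) (w : E → ℤ) (p : E → ℝ) (hp : ∀ e, 0 < p e ∧ (p e : EReal) < Γ.length e)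

lemma build_nonneg (hd : 0 ≤ d) (hw : 0 ≤ w) : 0 ≤ build d w p hp := by
  refine add_nonneg (Finset.sum_nonneg fun v _ => ?_) (Finset.sum_nonneg fun e _ => ?_)
  · exact Finsupp.single_nonneg.2 (hd v)
  · exact Finsupp.single_nonneg.2 (hw e)

lemma vertexPart_build : vertexPart (build d w p hp) = d := by
  classical
  ext v
  simp [vertexPart, build, Finsupp.single_apply]

lemma edgePart_build (e : E) : edgePart e (build d w p hp) = Finsupp.single (p e) (w e) := by
  rw [build, map_add, map_sum, map_sum, Finset.sum_eq_zero fun v _ => edgePart_single_vertex e v _,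
    zero_add, Finset.sum_eq_single e]
  · exact edgePart_single_interior _ _ _ _ _
  · intro e' _ hne
    exact edgePart_single_interior_of_ne hne _ _ _ _
  · simp

lemma edgeDeg_build (e : E) : edgeDeg e (build d w p hp) = w e := by
  rw [edgeDeg_apply, edgePart_build, Finsupp.sum_single_index rfl]

lemma shift_build (a : E ⊕ E) : shift (build d w p hp) a =
    w (a.elim id id) * Γ.weight a (p (a.elim id id)) := by
  rw [shift, edgeSum_apply, edgePart_build, Finsupp.sum_single_index (by simp)]

end Finite

/-! ### Principal divisors in algebraic form -/

section Principal

lemma rise_inl_add_inr (D : Γ.Divisor) (x : V → ℝ) (e : E) :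
    Γ.darts.rise (shift D) x (.inl e) + Γ.darts.rise (shift D) x (.inr e) = edgeDeg e D := by
  have h := shift_inl_add_inr D e
  have h' := Γ.len_pos e
  simp only [DartGraph.rise, DartGraph.head, darts, Sum.swap_inl, Sum.swap_inr, Sum.elim_inl,
    Sum.elim_inr]
  field_simp
  linarith

lemma rise_inl (D : Γ.Divisor) (x : V → ℝ) (e : E) : Γ.darts.rise (shift D) x (.inl e) =
    (x (Γ.tgt e) - x (Γ.src e) + shift D (.inl e)) / Γ.len e := rfl

variable [Fintype E]

open Classical in
/-- `D` is the divisor of the function with values `x` at the vertices and initial slope `m e`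
on the edge `e`. -/
def IsDivisorOf (D : Γ.Divisor) (x : V → ℝ) (m : E → ℤ) : Prop :=
  (∀ e, x (Γ.tgt e) - x (Γ.src e) = m e * Γ.len e + shift D (.inl e)) ∧
  ∀ v, vertexPart D v = (∑ e : E, if Γ.src e = v then m e else 0) +
    ∑ e : E, if Γ.tgt e = v then -(m e + edgeDeg e D) else 0

open Classical in
/-- At the unbounded ends the vertex values are irrelevant. -/
lemma exists_isDivisorOf_of_finite {D : Γ.Divisor} {x : V → ℝ} {m : E → ℤ}
    (h1 : ∀ e, Γ.length e ≠ ⊤ →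
      x (Γ.tgt e) - x (Γ.src e) = m e * Γ.len e + shift D (.inl e))
    (h2 : ∀ v, vertexPart D v = (∑ e : E, if Γ.src e = v then m e else 0) +
      ∑ e : E, if Γ.tgt e = v then -(m e + edgeDeg e D) else 0) :
    ∃ y, IsDivisorOf D y m := by
  classical
  -- An unbounded end lies on one edge only, so its value is free to be chosen to satisfy the
  -- equation of that edge.
  let y : V → ℝ := fun v =>
    if h : ∃ e, Γ.length e = ⊤ ∧ Γ.tgt e = v then x (Γ.src h.choose) + m h.choose else x v
  have hys : ∀ e, y (Γ.src e) = x (Γ.src e) := by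
    intro e
    refine dif_neg ?_
    rintro ⟨e', h, h'⟩
    exact (Γ.infinite_leaf e' h).1 e h'.symm
  refine ⟨y, fun e => ?_, fun v => by convert h2 v⟩
  by_cases h : Γ.length e = ⊤
  · have hex : ∃ e', Γ.length e' = ⊤ ∧ Γ.tgt e' = Γ.tgt e := ⟨e, h, rfl⟩
    have hch : hex.choose = e := (Γ.infinite_leaf e h).2 _ hex.choose_spec.2
    have hy : y (Γ.tgt e) = x (Γ.src e) + m e := by
      simp only [y]
      rw [dif_pos hex, hch]
    rw [hy, hys]
    simp [weight, h, len, shift, edgeSum_apply]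
  · have hy : y (Γ.tgt e) = x (Γ.tgt e) := by
      refine dif_neg ?_
      rintro ⟨e', h1, h2⟩
      rw [(Γ.infinite_leaf e' h1).2 e h2.symm] at h
      exact h h1
    rw [hy, hys]
    exact h1 e h

variable (Γ) in
/-- The algebraic form of non-emptiness of the linear system. -/
def Eff (D : Γ.Divisor) : Prop := Γ.darts.Effective (vertexPart D) (shift D)

lemma Eff.add {D D' : Γ.Divisor} (h : Γ.Eff D) (h' : Γ.Eff D') : Γ.Eff (D + D') := by
  rw [Eff, vertexPart_add, shift_add]
  exact DartGraph.Effective.add _ h h'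

open Classical in
lemma net_eq (D : Γ.Divisor) (x : V → ℝ) (v : V) :
    Γ.darts.net (vertexPart D) (shift D) x v = vertexPart D v +
      ((∑ e : E, if Γ.src e = v then ⌊Γ.darts.rise (shift D) x (.inl e)⌋ else 0) +
      ∑ e : E, if Γ.tgt e = v then ⌊Γ.darts.rise (shift D) x (.inr e)⌋ else 0) := by
  rw [DartGraph.net, Finset.sum_filter, Fintype.sum_sum_type]
  rfl

/-- Interior chips of `D'` are non-negative, so the outgoing slopes at both ends of an edge are
integers not exceeding the rises of `D`, hence not exceeding their floors. -/
lemma IsDivisorOf.le_net {D D' : Γ.Divisor} {x : V → ℝ} {m : E → ℤ}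
    (h : IsDivisorOf (D' - D) x m) (hD' : 0 ≤ D') (v : V) :
    vertexPart D' v ≤ Γ.darts.net (vertexPart D) (shift D) x v := by
  classical
  have h1 : ∀ e, Γ.darts.rise (shift D) x (.inl e) = m e + shift D' (.inl e) / Γ.len e := by
    intro e
    have h0 := h.1 e
    have h' := (Γ.len_pos e).ne'
    rw [shift_sub, Pi.sub_apply] at h0
    rw [rise_inl, h0]
    field_simp
    ring
  have h2 : ∀ e, m e ≤ ⌊Γ.darts.rise (shift D) x (.inl e)⌋ := by
    intro e
    rw [Int.le_floor, h1]
    have := div_nonneg (shift_nonneg hD' (.inl e)) (Γ.len_pos e).le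
    linarith
  have h3 : ∀ e, -(m e + edgeDeg e (D' - D)) ≤ ⌊Γ.darts.rise (shift D) x (.inr e)⌋ := by
    intro e
    have h4 := rise_inl_add_inr D x e
    have h5 := shift_inl_add_inr D' e
    have h6 := div_nonneg (shift_nonneg hD' (.inr e)) (Γ.len_pos e).le
    have h7 : shift D' (.inl e) / Γ.len e + shift D' (.inr e) / Γ.len e = edgeDeg e D' := by
      rw [← add_div, h5, mul_div_cancel_right₀ _ (Γ.len_pos e).ne']
    rw [Int.le_floor, map_sub]
    push_cast
    linarith [h1 e]
  have h4 : (∑ e : E, if Γ.src e = v then m e else 0) ≤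
      ∑ e : E, if Γ.src e = v then ⌊Γ.darts.rise (shift D) x (.inl e)⌋ else 0 :=
    Finset.sum_le_sum fun e _ => by split_ifs <;> simp [h2]
  have h5 : (∑ e : E, if Γ.tgt e = v then -(m e + edgeDeg e (D' - D)) else 0) ≤
      ∑ e : E, if Γ.tgt e = v then ⌊Γ.darts.rise (shift D) x (.inr e)⌋ else 0 :=
    Finset.sum_le_sum fun e _ => by
      split_ifs
      · exact h3 e
      · exact le_rfl
  have h6 := h.2 v
  rw [vertexPart_sub, Pi.sub_apply] at h6
  rw [net_eq]
  linarith

lemma IsDivisorOf.eff {D D' : Γ.Divisor} {x : V → ℝ} {m : E → ℤ}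
    (h : IsDivisorOf (D' - D) x m) (hD' : 0 ≤ D') : Γ.Eff D :=
  ⟨x, fun v => (hD' _).trans (h.le_net hD' v)⟩

variable [Fintype V]

lemma IsDivisorOf.deg_eq_zero {D : Γ.Divisor} {x : V → ℝ} {m : E → ℤ} (h : IsDivisorOf D x m) :
    deg D = 0 := by
  classical
  rw [deg_eq_sum, Finset.sum_congr rfl fun v _ => h.2 v, Finset.sum_add_distrib, Finset.sum_comm,
    Finset.sum_comm (s := Finset.univ (α := V))]
  simp [← Finset.sum_add_distrib]

lemma degree_eq (D : Γ.Divisor) :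
    ∑ v, (vertexPart D v : ℝ) + ∑ a, shift D a / Γ.darts.len a = deg D := by
  rw [deg_eq_sum, Fintype.sum_sum_type, ← Finset.sum_add_distrib]
  push_cast
  congr 1
  refine Finset.sum_congr rfl fun e _ => ?_
  rw [show Γ.darts.len (.inl e) = Γ.len e from rfl, show Γ.darts.len (.inr e) = Γ.len e from rfl,
    ← add_div, shift_inl_add_inr, mul_div_cancel_right₀ _ (Γ.len_pos e).ne']

lemma Eff.deg_nonneg {D : Γ.Divisor} (h : Γ.Eff D) : 0 ≤ deg D := by
  have := DartGraph.Effective.degree_nonneg _ h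
  rw [degree_eq] at this
  exact_mod_cast this

lemma Eff.neg {D : Γ.Divisor} (h : Γ.Eff D) (h0 : deg D = 0) : Γ.Eff (-D) := by
  rw [Eff, vertexPart_neg, shift_neg]
  refine DartGraph.Effective.neg_of_degree_eq_zero _ h ?_
  rw [degree_eq, h0, Int.cast_zero]

/-- An effective divisor in the linear system of an `Eff` divisor. -/
lemma Eff.exists_isDivisorOf {D : Γ.Divisor} (h : Γ.Eff D) :
    ∃ (D' : Γ.Divisor) (x : V → ℝ) (m : E → ℤ), 0 ≤ D' ∧ IsDivisorOf (D' - D) x m := by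
  classical
  obtain ⟨x, hx⟩ := h
  let u : E → ℝ := fun e => Γ.darts.rise (shift D) x (.inl e)
  let w : E → ℤ := fun e => if Int.fract (u e) = 0 then 0 else 1
  let p : E → ℝ := fun e =>
    if Int.fract (u e) = 0 then Γ.len e / 2 else Γ.len e * (1 - Int.fract (u e))
  have hlen := Γ.len_pos
  have hp' : ∀ e, 0 < p e ∧ p e < Γ.len e := by
    intro e
    have h1 := hlen e
    have h2 := Int.fract_lt_one (u e)
    simp only [p]
    split_ifs with h0
    · constructor <;> linarith
    · have h3 := lt_of_le_of_ne (Int.fract_nonneg (u e)) (Ne.symm h0)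
      constructor
      · exact mul_pos h1 (by linarith)
      · nlinarith
  have hp : ∀ e, 0 < p e ∧ (p e : EReal) < Γ.length e := fun e =>
    ⟨(hp' e).1, (EReal.coe_lt_coe_iff.2 (hp' e).2).trans_le (Γ.coe_len_le e)⟩
  let D' := build (Γ.darts.net (vertexPart D) (shift D) x) w p hp
  suffices h : ∃ y, IsDivisorOf (D' - D) y fun e => ⌊u e⌋ from
    ⟨D', h.choose, _, build_nonneg _ _ _ _ hx fun e => by simp only [w]; split_ifs <;> simp,
      h.choose_spec⟩
  refine exists_isDivisorOf_of_finite (x := x) (fun e h => ?_) fun v => ?_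
  · rw [shift_sub, Pi.sub_apply, shift_build]
    simp only [Sum.elim_inl, id]
    have h1 : u e * Γ.len e = x (Γ.tgt e) - x (Γ.src e) + shift D (.inl e) :=
      div_mul_cancel₀ _ (hlen e).ne'
    have h2 := Int.floor_add_fract (u e)
    have h3 : (w e : ℝ) * Γ.weight (.inl e) (p e) = Γ.len e * Int.fract (u e) := by
      simp only [weight, h, if_false, w, p]
      split_ifs with h0
      · simp [h0]
      · push_cast
        ring
    rw [h3]
    rw [← h2] at h1
    linarith
  · rw [vertexPart_sub, Pi.sub_apply, vertexPart_build, net_eq, add_sub_cancel_left]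
    congr 1
    refine Finset.sum_congr rfl fun e _ => ?_
    split_ifs with hv
    · have h1 : Γ.darts.rise (shift D) x (.inr e) = edgeDeg e D - u e := by
        rw [← rise_inl_add_inr D x e]
        simp [u]
      rw [h1, map_sub, edgeDeg_build, sub_eq_add_neg (edgeDeg e D : ℝ), Int.floor_intCast_add]
      have h2 : ⌊-u e⌋ = -(⌊u e⌋ + w e) := by
        simp only [w]
        split_ifs with h0
        · have h3 : u e = ⌊u e⌋ := by
            have := Int.floor_add_fract (u e)
            linarith
          rw [h3, ← Int.cast_neg, Int.floor_intCast, Int.floor_intCast]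
          ring
        · rw [Int.floor_eq_iff]
          have h3 := Int.floor_add_fract (u e)
          have h4 := Int.fract_lt_one (u e)
          have h5 := lt_of_le_of_ne (Int.fract_nonneg (u e)) (Ne.symm h0)
          push_cast
          constructor <;> linarith
      rw [h2]
      ring
    · rfl

end Principal

end TropicalCurve

namespace TropicalCurve

variable {V E : Type*} {Γ : TropicalCurve V E}

/-! ### Continuity along the parametrized edges -/

section Param

lemma param_of_mem {e : E} {t : ℝ} (h0 : 0 < t) (h1 : (t : EReal) < Γ.length e) :
    Γ.param e t = .interior e t h0 h1 := by
  simp [param, h0, h1]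

lemma param_zero (e : E) : Γ.param e 0 = .vertex (Γ.src e) := by
  simp [param]

lemma param_length (e : E) : Γ.param e (Γ.length e) = .vertex (Γ.tgt e) := by
  have h : ¬ (0 < (Γ.length e).toReal ∧ ((Γ.length e).toReal : EReal) < Γ.length e) := by
    by_cases h : Γ.length e = ⊤
    · simp [h]
    · rw [EReal.coe_toReal h (Γ.length_pos e).ne_bot]
      simp
  rw [param, dif_neg h, if_neg (Γ.length_pos e).not_ge]

lemma continuous_param (e : E) :
    Continuous fun t : Set.Icc (0 : EReal) (Γ.length e) => Γ.param e t :=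
  continuous_iSup_rng (i := e) continuous_coinduced_rng

lemma continuous_iff_param {f : Γ.Point → EReal} : Continuous f ↔
    ∀ e, Continuous fun t : Set.Icc (0 : EReal) (Γ.length e) => f (Γ.param e t) := by
  refine continuous_iSup_dom.trans (forall_congr' fun e => ?_)
  exact continuous_coinduced_dom

lemma continuousOn_comp_param {f : Γ.Point → EReal} (hf : Continuous f) (e : E) :
    ContinuousOn (fun t : ℝ => f (Γ.param e t)) {t | 0 ≤ t ∧ (t : EReal) ≤ Γ.length e} := by
  have h : ContinuousOn (fun t : EReal => f (Γ.param e t)) (Set.Icc 0 (Γ.length e)) := by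
    rw [continuousOn_iff_continuous_domRestrict]
    exact hf.comp (continuous_param e)
  refine h.comp continuous_coe_real_ereal.continuousOn fun t ht => ⟨?_, ht.2⟩
  exact_mod_cast ht.1

lemma eventually_coe_lt {c : EReal} {t₀ : ℝ} (h : (t₀ : EReal) < c) :
    ∀ᶠ t : ℝ in 𝓝 t₀, (t : EReal) < c :=
  continuous_coe_real_ereal.continuousAt.eventually (gt_mem_nhds h)

/-- The parameters of the internal points of an edge. -/
def interval (Γ : TropicalCurve V E) (e : E) : Set ℝ := {t | 0 < t ∧ (t : EReal) < Γ.length e}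

lemma isOpen_interval (e : E) : IsOpen (Γ.interval e) :=
  isOpen_iff_mem_nhds.2 fun _ ht => (lt_mem_nhds ht.1).and (eventually_coe_lt ht.2)

lemma isPreconnected_interval (e : E) : IsPreconnected (Γ.interval e) := by
  have : (Γ.interval e).OrdConnected := ⟨fun a ha b hb t ht =>
    ⟨ha.1.trans_le ht.1, (EReal.coe_le_coe_iff.2 ht.2).trans_lt hb.2⟩⟩
  exact this.isPreconnected

lemma interval_mem_nhdsGT {e : E} {t₀ : ℝ} (h0 : 0 ≤ t₀) (h1 : (t₀ : EReal) < Γ.length e) :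
    Γ.interval e ∈ 𝓝[>] t₀ := by
  filter_upwards [self_mem_nhdsWithin, mem_nhdsWithin_of_mem_nhds (eventually_coe_lt h1)]
    with t ht ht'
  exact ⟨h0.trans_lt ht, ht'⟩

lemma interval_mem_nhdsLT {e : E} {t₀ : ℝ} (h0 : 0 < t₀) (h1 : (t₀ : EReal) ≤ Γ.length e) :
    Γ.interval e ∈ 𝓝[<] t₀ := by
  filter_upwards [self_mem_nhdsWithin, mem_nhdsWithin_of_mem_nhds (lt_mem_nhds h0)] with t ht ht'
  exact ⟨ht', (EReal.coe_lt_coe_iff.2 ht).trans_le h1⟩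

lemma endFilter_of_top {e : E} (h : Γ.length e = ⊤) : Γ.endFilter e = atTop := if_pos h

lemma endFilter_of_ne_top {e : E} (h : Γ.length e ≠ ⊤) : Γ.endFilter e = 𝓝[<] (Γ.len e) := by
  rw [endFilter, if_neg h, len, if_neg h]

lemma interval_mem_endFilter (e : E) : Γ.interval e ∈ Γ.endFilter e := by
  by_cases h : Γ.length e = ⊤
  · rw [endFilter_of_top h]
    filter_upwards [eventually_gt_atTop 0] with t ht
    exact ⟨ht, by rw [h]; exact EReal.coe_lt_top t⟩
  · rw [endFilter_of_ne_top h]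
    exact interval_mem_nhdsLT (Γ.len_pos e) (Γ.coe_len_le e)

end Param

/-! ### Slopes of piecewise linear functions -/

section Slope

/-- A filter on the line that determines slopes. -/
class SlopeFilter (F : Filter ℝ) : Prop where
  neBot : F.NeBot
  eventually_ne : ∀ b, ∀ᶠ t in F, t ≠ b

instance (a : ℝ) : SlopeFilter (𝓝[>] a) where
  neBot := inferInstance
  eventually_ne b := by
    by_cases h : a = b
    · filter_upwards [self_mem_nhdsWithin] with t ht
      exact h ▸ ht.ne'
    · exact mem_nhdsWithin_of_mem_nhds (isOpen_ne.mem_nhds h)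

instance (a : ℝ) : SlopeFilter (𝓝[<] a) where
  neBot := inferInstance
  eventually_ne b := by
    by_cases h : a = b
    · filter_upwards [self_mem_nhdsWithin] with t ht
      exact h ▸ ht.ne
    · exact mem_nhdsWithin_of_mem_nhds (isOpen_ne.mem_nhds h)

instance (e : E) : SlopeFilter (Γ.endFilter e) := by
  by_cases h : Γ.length e = ⊤
  · rw [endFilter_of_top h]
    exact ⟨inferInstance, fun b => eventually_ne_atTop b⟩
  · rw [endFilter_of_ne_top h]
    infer_instance

lemma HasSlope.slope_eq {f : Γ.Point → EReal} {e : E} {F : Filter ℝ} [hF : SlopeFilter F] {m : ℤ}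
    (h : Γ.HasSlope f e F m) : Γ.slope f e F = m := by
  have h' : Γ.HasSlope f e F (Γ.slope f e F) := Classical.epsilon_spec ⟨m, h⟩
  set m' := Γ.slope f e F
  obtain ⟨c, hc⟩ := h
  obtain ⟨c', hc'⟩ := h'
  by_contra hne
  have hne' : (m' : ℝ) - m ≠ 0 := sub_ne_zero.2 (by exact_mod_cast hne)
  have := hF.neBot
  obtain ⟨t, h1, h2, h3⟩ := (hc.and (hc'.and (hF.eventually_ne ((c - c') / (m' - m))))).exists
  rw [h1, EReal.coe_eq_coe_iff] at h2
  exact h3 (by rw [eq_div_iff hne']; linarith)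

-- `σ` marks the chips already passed at `t`. A chip at `t` itself contributes zero under either
-- choice, so the same formula serves both one-sided limits.
open Classical in
lemma edgeSum_max_eq (D : Γ.Divisor) (e : E) (σ : ℝ → Prop) (t : ℝ)
    (h : ∀ s ∈ (edgePart e D).support, (σ s → s ≤ t) ∧ (¬ σ s → t ≤ s)) :
    edgeSum e (fun s => max (t - s) 0) D =
      ((∑ s ∈ (edgePart e D).support with σ s, edgePart e D s : ℤ) : ℝ) * t -
        ∑ s ∈ (edgePart e D).support with σ s, (edgePart e D s : ℝ) * s := by
  rw [edgeSum_apply, Finsupp.sum]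
  push_cast
  rw [Finset.sum_mul, ← Finset.sum_sub_distrib, Finset.sum_filter]
  refine Finset.sum_congr rfl fun s hs => ?_
  split_ifs with hσ
  · rw [max_eq_left (by linarith [(h s hs).1 hσ])]
    ring
  · rw [max_eq_right (by linarith [(h s hs).2 hσ]), mul_zero]

open Classical in
lemma eventually_edgeSum_max_eq (D : Γ.Divisor) (e : E) (σ : ℝ → Prop) (F : Filter ℝ)
    (h : ∀ s ∈ (edgePart e D).support,
      (σ s → ∀ᶠ t in F, s ≤ t) ∧ (¬ σ s → ∀ᶠ t in F, t ≤ s)) :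
    ∀ᶠ t in F, edgeSum e (fun s => max (t - s) 0) D =
      ((∑ s ∈ (edgePart e D).support with σ s, edgePart e D s : ℤ) : ℝ) * t -
        ∑ s ∈ (edgePart e D).support with σ s, (edgePart e D s : ℝ) * s := by
  have h' : ∀ᶠ t in F, ∀ s ∈ (edgePart e D).support, (σ s → s ≤ t) ∧ (¬ σ s → t ≤ s) := by
    rw [Finset.eventually_all]
    intro s hs
    by_cases hσ : σ s
    · filter_upwards [(h s hs).1 hσ] with t ht
      exact ⟨fun _ => ht, fun h => absurd hσ h⟩
    · filter_upwards [(h s hs).2 hσ] with t ht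
      exact ⟨fun h => absurd h hσ, fun _ => ht⟩
  filter_upwards [h'] with t ht
  exact edgeSum_max_eq D e σ t ht

lemma sides_nhdsGT (t₀ s : ℝ) :
    (s ≤ t₀ → ∀ᶠ t in 𝓝[>] t₀, s ≤ t) ∧ (¬ s ≤ t₀ → ∀ᶠ t in 𝓝[>] t₀, t ≤ s) := by
  constructor
  · intro hs
    filter_upwards [self_mem_nhdsWithin] with t ht
    exact hs.trans (le_of_lt ht)
  · intro hs
    exact mem_nhdsWithin_of_mem_nhds (Iic_mem_nhds (not_le.1 hs))

lemma sides_nhdsLT (t₀ s : ℝ) :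
    (s < t₀ → ∀ᶠ t in 𝓝[<] t₀, s ≤ t) ∧ (¬ s < t₀ → ∀ᶠ t in 𝓝[<] t₀, t ≤ s) := by
  constructor
  · intro hs
    exact mem_nhdsWithin_of_mem_nhds (Ici_mem_nhds hs)
  · intro hs
    filter_upwards [self_mem_nhdsWithin] with t ht
    exact (le_of_lt ht).trans (not_lt.1 hs)

open Classical in
lemma sum_le_sub_sum_lt (k : ℝ →₀ ℤ) (t₀ : ℝ) :
    ∑ s ∈ k.support with s ≤ t₀, k s - ∑ s ∈ k.support with s < t₀, k s = k t₀ := by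
  rw [Finset.sum_filter, Finset.sum_filter, ← Finset.sum_sub_distrib]
  have : ∀ s ∈ k.support, (if s ≤ t₀ then k s else 0) - (if s < t₀ then k s else 0) =
      if s = t₀ then k s else 0 := by
    intro s _
    rcases lt_trichotomy s t₀ with h | h | h
    · simp [h, h.le, h.ne]
    · simp [h]
    · simp [h.not_ge, h.not_gt, h.ne']
  rw [Finset.sum_congr rfl this, Finset.sum_ite_eq']
  split_ifs with h
  · rfl
  · exact (Finsupp.notMem_support_iff.1 h).symm

/-- On the edge `e`, the function `f` has initial value `c`, initial slope `m`, and the changes of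
slope prescribed by `D`. -/
def IsPiecewiseLinearOn (f : Γ.Point → EReal) (e : E) (D : Γ.Divisor) (c : ℝ) (m : ℤ) : Prop :=
  ∀ t ∈ Γ.interval e,
    f (Γ.param e t) = ((c + m * t + edgeSum e (fun s => max (t - s) 0) D : ℝ) : EReal)

variable {f : Γ.Point → EReal} {e : E} {D : Γ.Divisor} {c : ℝ} {m : ℤ}

open Classical in
lemma IsPiecewiseLinearOn.hasSlope (h : IsPiecewiseLinearOn f e D c m) (σ : ℝ → Prop) (F : Filter ℝ)
    (hF : Γ.interval e ∈ F) (hσ : ∀ s ∈ (edgePart e D).support,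
      (σ s → ∀ᶠ t in F, s ≤ t) ∧ (¬ σ s → ∀ᶠ t in F, t ≤ s)) :
    Γ.HasSlope f e F (m + ∑ s ∈ (edgePart e D).support with σ s, edgePart e D s) := by
  refine ⟨c - ∑ s ∈ (edgePart e D).support with σ s, (edgePart e D s : ℝ) * s, ?_⟩
  filter_upwards [hF, eventually_edgeSum_max_eq D e σ F hσ] with t ht ht'
  rw [h t ht, ht', EReal.coe_eq_coe_iff]
  push_cast
  ring

lemma IsPiecewiseLinearOn.slope_start (h : IsPiecewiseLinearOn f e D c m) :
    Γ.slope f e (𝓝[>] 0) = m := by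
  classical
  have h1 := h.hasSlope (fun s => s ≤ 0) (𝓝[>] 0)
    (interval_mem_nhdsGT le_rfl (by simpa using Γ.length_pos e)) fun s _ => sides_nhdsGT 0 s
  rw [h1.slope_eq, Finset.filter_false_of_mem, Finset.sum_empty, add_zero]
  intro s hs
  exact not_le.2 (mem_of_mem_support hs).1

lemma eventually_le_endFilter {s : ℝ} (hs : s ∈ Γ.interval e) : ∀ᶠ t in Γ.endFilter e, s ≤ t := by
  by_cases h : Γ.length e = ⊤
  · rw [endFilter_of_top h]
    exact eventually_ge_atTop s
  · rw [endFilter_of_ne_top h]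
    refine mem_nhdsWithin_of_mem_nhds (Ici_mem_nhds ?_)
    have := hs.2
    rw [← Γ.coe_len h] at this
    exact_mod_cast this

lemma IsPiecewiseLinearOn.slope_end (h : IsPiecewiseLinearOn f e D c m) :
    Γ.slope f e (Γ.endFilter e) = m + edgeDeg e D := by
  classical
  have h1 := h.hasSlope (fun _ => True) (Γ.endFilter e) (interval_mem_endFilter e)
    fun s hs => ⟨fun _ => eventually_le_endFilter (mem_of_mem_support hs),
      fun h => absurd trivial h⟩
  rw [h1.slope_eq, Finset.filter_true]
  rfl

lemma IsPiecewiseLinearOn.slope_sub_slope (h : IsPiecewiseLinearOn f e D c m) {t : ℝ}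
    (ht : t ∈ Γ.interval e) :
    Γ.slope f e (𝓝[>] t) - Γ.slope f e (𝓝[<] t) = edgePart e D t := by
  classical
  rw [(h.hasSlope (fun s => s ≤ t) _ (interval_mem_nhdsGT ht.1.le ht.2)
      fun s _ => sides_nhdsGT t s).slope_eq,
    (h.hasSlope (fun s => s < t) _ (interval_mem_nhdsLT ht.1 ht.2.le)
      fun s _ => sides_nhdsLT t s).slope_eq, ← sum_le_sub_sum_lt]
  ring

lemma continuous_edgeSum_max (D : Γ.Divisor) (e : E) :
    Continuous fun t : ℝ => edgeSum e (fun s => max (t - s) 0) D := by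
  simp only [edgeSum_apply, Finsupp.sum]
  fun_prop

lemma edgeSum_max_zero (D : Γ.Divisor) (e : E) : edgeSum e (fun s => max (0 - s) 0) D = 0 := by
  rw [edgeSum_apply]
  refine Finset.sum_eq_zero fun s hs => ?_
  simp only
  rw [max_eq_right (by linarith [(mem_of_mem_support hs).1]), mul_zero]

lemma edgeSum_max_len (D : Γ.Divisor) {e : E} (h : Γ.length e ≠ ⊤) :
    edgeSum e (fun s => max (Γ.len e - s) 0) D = shift D (.inl e) := by
  rw [shift, edgeSum_apply, edgeSum_apply]
  refine Finset.sum_congr rfl fun s hs => ?_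
  have h1 : (s : EReal) < Γ.length e := (mem_of_mem_support hs).2
  rw [← Γ.coe_len h] at h1
  have h2 : s < Γ.len e := by exact_mod_cast h1
  simp only [Sum.elim_inl, id, weight, h, if_false]
  rw [max_eq_left (by linarith)]

end Slope

/-! ### From rational functions to algebraic data -/

section OfRational

lemma IsRational.exists_hasSlope_nhdsGT {f : Γ.Point → EReal} (hf : Γ.IsRational f) {e : E}
    {t₀ : ℝ} (h0 : 0 ≤ t₀) (h1 : (t₀ : EReal) < Γ.length e) :
    ∃ m, Γ.HasSlope f e (𝓝[>] t₀) m := by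
  obtain ⟨S, hS⟩ := hf.piecewise_linear e
  have hev : ∀ᶠ b in 𝓝[>] t₀, ∀ s ∈ S, s ∉ Set.Ioo t₀ b := by
    rw [Finset.eventually_all]
    intro s _
    by_cases hs : s ≤ t₀
    · exact Eventually.of_forall fun b hb => hb.1.not_ge hs
    · filter_upwards [mem_nhdsWithin_of_mem_nhds (Iic_mem_nhds (not_le.1 hs))] with b hb hsb
      exact hsb.2.not_ge hb
  have hI : ∀ᶠ t in 𝓝[>] t₀, t ∈ Γ.interval e := interval_mem_nhdsGT h0 h1
  obtain ⟨b, hb, hbI, hbt⟩ := (hev.and (hI.and self_mem_nhdsWithin)).exists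
  obtain ⟨m, c, h⟩ := hS t₀ b h0 hbI.2.le hb
  exact ⟨m, c, Filter.mem_of_superset (Ioo_mem_nhdsGT hbt) h⟩

lemma IsRational.exists_hasSlope_nhdsLT {f : Γ.Point → EReal} (hf : Γ.IsRational f) {e : E}
    {t₀ : ℝ} (h0 : 0 < t₀) (h1 : (t₀ : EReal) ≤ Γ.length e) :
    ∃ m, Γ.HasSlope f e (𝓝[<] t₀) m := by
  obtain ⟨S, hS⟩ := hf.piecewise_linear e
  have hev : ∀ᶠ b in 𝓝[<] t₀, ∀ s ∈ S, s ∉ Set.Ioo b t₀ := by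
    rw [Finset.eventually_all]
    intro s _
    by_cases hs : t₀ ≤ s
    · exact Eventually.of_forall fun b hb => hb.2.not_ge hs
    · filter_upwards [mem_nhdsWithin_of_mem_nhds (Ici_mem_nhds (not_le.1 hs))] with b hb hsb
      exact hsb.1.not_ge hb
  have hI : ∀ᶠ t in 𝓝[<] t₀, t ∈ Γ.interval e := interval_mem_nhdsLT h0 h1
  obtain ⟨b, hb, hbI, hbt⟩ := (hev.and (hI.and self_mem_nhdsWithin)).exists
  obtain ⟨m, c, h⟩ := hS b t₀ hbI.1.le h1 hb
  exact ⟨m, c, Filter.mem_of_superset (Ioo_mem_nhdsLT hbt) h⟩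

lemma eventually_affine {ψ : ℝ → ℝ} {t₀ A B B' : ℝ} (hψ : ContinuousAt ψ t₀)
    (hl : ∀ᶠ t in 𝓝[<] t₀, ψ t = A * t + B) (hr : ∀ᶠ t in 𝓝[>] t₀, ψ t = A * t + B') :
    ∀ᶠ t in 𝓝 t₀, ψ t = A * t + B := by
  have hA : ∀ b : ℝ, Tendsto (fun t => A * t + b) (𝓝 t₀) (𝓝 (A * t₀ + b)) := fun b => by
    have : Continuous fun t => A * t + b := by fun_prop
    exact this.tendsto t₀
  have h1 : ψ t₀ = A * t₀ + B := tendsto_nhds_unique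
    ((hψ.tendsto.mono_left nhdsWithin_le_nhds).congr' hl) ((hA B).mono_left nhdsWithin_le_nhds)
  have h2 : ψ t₀ = A * t₀ + B' := tendsto_nhds_unique
    ((hψ.tendsto.mono_left nhdsWithin_le_nhds).congr' hr) ((hA B').mono_left nhdsWithin_le_nhds)
  rw [eventually_nhdsWithin_iff] at hl hr
  filter_upwards [hl, hr] with t htl htr
  rcases lt_trichotomy t t₀ with h | h | h
  · exact htl h
  · rw [h, h1]
  · rw [htr h]
    linarith

lemma IsRational.param_ne {f : Γ.Point → EReal} (hf : Γ.IsRational f) {e : E} {t : ℝ}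
    (ht : t ∈ Γ.interval e) : f (Γ.param e t) ≠ ⊤ ∧ f (Γ.param e t) ≠ ⊥ := by
  rw [param_of_mem ht.1 ht.2]
  constructor <;> intro h
  · obtain ⟨_, _, h'⟩ := hf.finite _ (Or.inl h)
    cases h'
  · obtain ⟨_, _, h'⟩ := hf.finite _ (Or.inr h)
    cases h'

variable [Fintype E]

/-- The behaviour of a rational function on an edge is determined by its initial slope and its
divisor. -/
lemma IsRational.exists_isPiecewiseLinearOn {f : Γ.Point → EReal} (hf : Γ.IsRational f)
    {D : Γ.Divisor} (hD : ∀ p, D p = Γ.ord f p) (e : E) :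
    ∃ c, IsPiecewiseLinearOn f e D c (Γ.slope f e (𝓝[>] 0)) := by
  classical
  set m := Γ.slope f e (𝓝[>] 0)
  let g : ℝ → ℝ := fun t => (f (Γ.param e t)).toReal
  have hg : ∀ t ∈ Γ.interval e, f (Γ.param e t) = (g t : EReal) := fun t ht =>
    (EReal.coe_toReal (hf.param_ne ht).1 (hf.param_ne ht).2).symm
  have hgc : ∀ t ∈ Γ.interval e, ContinuousAt g t := by
    intro t ht
    have h1 := (continuousOn_comp_param hf.continuous e).continuousAt
      (mem_of_superset ((isOpen_interval e).mem_nhds ht) fun s hs => ⟨hs.1.le, hs.2.le⟩)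
    exact (EReal.tendsto_toReal (hf.param_ne ht).1 (hf.param_ne ht).2).comp h1
  -- `ψ` is `f` minus the linear term and the kinks predicted by `D`. The slope jumps cancel at each
  -- interior point, so `ψ` should be constant.
  let ψ : ℝ → ℝ := fun t => g t - m * t - edgeSum e (fun s => max (t - s) 0) D
  have hlocal : ∀ (F : Filter ℝ) (σ : ℝ → Prop) (k : ℤ), Γ.interval e ∈ F →
      Γ.HasSlope f e F k → (∀ s ∈ (edgePart e D).support,
        (σ s → ∀ᶠ t in F, s ≤ t) ∧ (¬ σ s → ∀ᶠ t in F, t ≤ s)) →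
      ∃ B : ℝ, ∀ᶠ t in F, ψ t =
        ((k - m - ∑ s ∈ (edgePart e D).support with σ s, edgePart e D s : ℤ) : ℝ) * t + B := by
    rintro F σ k hF ⟨c, hc⟩ hσ
    refine ⟨c + ∑ s ∈ (edgePart e D).support with σ s, (edgePart e D s : ℝ) * s, ?_⟩
    filter_upwards [hF, hc, eventually_edgeSum_max_eq D e σ F hσ] with t ht h1 h2
    rw [hg t ht, EReal.coe_eq_coe_iff] at h1
    simp only [ψ, h1, h2]
    push_cast
    ring
  have haff : ∀ t ∈ Γ.interval e, ∃ A B : ℝ, ∀ᶠ s in 𝓝 t, ψ s = A * s + B := by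
    intro t ht
    obtain ⟨k₁, h₁⟩ := hf.exists_hasSlope_nhdsLT ht.1 ht.2.le
    obtain ⟨k₂, h₂⟩ := hf.exists_hasSlope_nhdsGT ht.1.le ht.2
    obtain ⟨B, hB⟩ := hlocal _ (fun s => s < t) k₁ (interval_mem_nhdsLT ht.1 ht.2.le) h₁
      fun s _ => sides_nhdsLT t s
    obtain ⟨B', hB'⟩ := hlocal _ (fun s => s ≤ t) k₂ (interval_mem_nhdsGT ht.1.le ht.2) h₂
      fun s _ => sides_nhdsGT t s
    have hk : edgePart e D t = k₂ - k₁ := by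
      rw [edgePart_apply_of_mem D ht.1 ht.2, hD, ord, h₁.slope_eq, h₂.slope_eq]
    have hcoef : k₂ - m - ∑ s ∈ (edgePart e D).support with s ≤ t, edgePart e D s =
        k₁ - m - ∑ s ∈ (edgePart e D).support with s < t, edgePart e D s := by
      have := sum_le_sub_sum_lt (edgePart e D) t
      linarith
    rw [hcoef] at hB'
    refine ⟨_, B, eventually_affine ?_ hB hB'⟩
    exact ((hgc t ht).sub (by fun_prop)).sub (continuous_edgeSum_max D e).continuousAt
  have h0 : (((0 : ℝ) : EReal)) < Γ.length e := by simpa using Γ.length_pos e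
  obtain ⟨k₀, hk₀⟩ := hf.exists_hasSlope_nhdsGT le_rfl h0
  have hk : k₀ = m := hk₀.slope_eq.symm
  obtain ⟨B, hB⟩ := hlocal _ (fun s => s ≤ 0) k₀ (interval_mem_nhdsGT le_rfl h0) hk₀
    fun s _ => sides_nhdsGT 0 s
  rw [Finset.filter_false_of_mem fun s hs => not_le.2 (mem_of_mem_support hs).1, hk] at hB
  simp only [sub_self, Finset.sum_empty, Int.cast_zero, zero_mul, zero_add] at hB
  obtain ⟨t₁, ht₁, ht₁'⟩ := (((eventually_eventually_nhdsWithin.2 hB).and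
    (interval_mem_nhdsGT le_rfl h0 : ∀ᶠ t in 𝓝[>] 0, t ∈ Γ.interval e))).exists
  rw [(isOpen_Ioi).nhdsWithin_eq (show t₁ ∈ Set.Ioi (0 : ℝ) from ht₁'.1)] at ht₁
  -- Locally affine functions are analytic, so constancy near the source spreads over the connected
  -- interval.
  have hana : AnalyticOnNhd ℝ ψ (Γ.interval e) := by
    intro t ht
    obtain ⟨A, B', h⟩ := haff t ht
    have : AnalyticAt ℝ (fun s : ℝ => A * s + B') t := by fun_prop
    exact this.congr (EventuallyEq.symm h)
  have hconst := hana.eqOn_of_preconnected_of_eventuallyEq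
    (analyticOnNhd_const (v := B)) (isPreconnected_interval e) ht₁' ht₁
  refine ⟨B, fun t ht => ?_⟩
  rw [hg t ht, EReal.coe_eq_coe_iff]
  have : ψ t = B := hconst ht
  simp only [ψ] at this
  linarith

/-- The divisor of a rational function is principal in the algebraic sense. -/
theorem IsRational.exists_isDivisorOf {f : Γ.Point → EReal} (hf : Γ.IsRational f) {D : Γ.Divisor}
    (hD : ∀ p, D p = Γ.ord f p) : ∃ (x : V → ℝ) (m : E → ℤ), IsDivisorOf D x m := by
  classical
  choose c hc using hf.exists_isPiecewiseLinearOn hD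
  let x : V → ℝ := fun v => (f (.vertex v)).toReal
  have hx : ∀ v, (∀ e, Γ.length e = ⊤ → v ≠ Γ.tgt e) → f (.vertex v) = (x v : EReal) := by
    intro v hv
    have h : ¬ Γ.IsUnboundedEnd (.vertex v) := by
      rintro ⟨e, he, h⟩
      exact hv e he (by injection h)
    exact (EReal.coe_toReal (fun h' => h (hf.finite _ (Or.inl h')))
      (fun h' => h (hf.finite _ (Or.inr h')))).symm
  -- Continuity carries the formula from the open edge to its finite ends.
  have hlim : ∀ (e : E) (t₀ : ℝ) (F : Filter ℝ) [F.NeBot], 0 ≤ t₀ → (t₀ : EReal) ≤ Γ.length e →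
      F ≤ 𝓝 t₀ → Γ.interval e ∈ F → f (Γ.param e t₀) =
        ((c e + Γ.slope f e (𝓝[>] 0) * t₀ +
          edgeSum e (fun s => max (t₀ - s) 0) D : ℝ) : EReal) := by
    intro e t₀ F _ h0 h1 hF hI
    have h2 := (continuousOn_comp_param hf.continuous e) t₀ ⟨h0, h1⟩
    have h3 : Tendsto (fun t : ℝ => f (Γ.param e t)) F (𝓝 (f (Γ.param e t₀))) :=
      h2.mono_left (le_inf hF (le_principal_iff.2
        (mem_of_superset hI fun s hs => ⟨hs.1.le, hs.2.le⟩)))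
    have h4 : Continuous fun t : ℝ => ((c e + Γ.slope f e (𝓝[>] 0) * t +
        edgeSum e (fun s => max (t - s) 0) D : ℝ) : EReal) :=
      continuous_coe_real_ereal.comp ((by fun_prop : Continuous fun t : ℝ =>
        c e + Γ.slope f e (𝓝[>] 0) * t).add (continuous_edgeSum_max D e))
    refine tendsto_nhds_unique h3 (((h4.tendsto t₀).mono_left hF).congr' ?_)
    filter_upwards [hI] with t ht
    exact (hc e t ht).symm
  have hsrc : ∀ e, x (Γ.src e) = c e := by
    intro e
    have h0 : (((0 : ℝ) : EReal)) < Γ.length e := by simpa using Γ.length_pos e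
    have h := hlim e 0 (𝓝[>] 0) le_rfl h0.le nhdsWithin_le_nhds (interval_mem_nhdsGT le_rfl h0)
    rw [edgeSum_max_zero, mul_zero, add_zero, add_zero, EReal.coe_zero, param_zero,
      hx _ fun e' he' => (Γ.infinite_leaf e' he').1 e, EReal.coe_eq_coe_iff] at h
    exact h
  have hedge : ∀ e, Γ.length e ≠ ⊤ → x (Γ.tgt e) - x (Γ.src e) =
      Γ.slope f e (𝓝[>] 0) * Γ.len e + shift D (.inl e) := by
    intro e he
    have h := hlim e (Γ.len e) (𝓝[<] (Γ.len e)) (Γ.len_pos e).le (Γ.coe_len_le e)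
      nhdsWithin_le_nhds (interval_mem_nhdsLT (Γ.len_pos e) (Γ.coe_len_le e))
    rw [edgeSum_max_len D he, Γ.coe_len he, param_length, hx, EReal.coe_eq_coe_iff] at h
    · rw [h, hsrc]
      ring
    · intro e' he' heq
      exact he ((Γ.infinite_leaf e' he').2 e heq ▸ he')
  obtain ⟨y, hy⟩ := exists_isDivisorOf_of_finite hedge fun v => by
    rw [vertexPart, hD, ord]
    congr 1
    refine Finset.sum_congr rfl fun e _ => ?_
    rw [(hc e).slope_end]
  exact ⟨y, _, hy⟩

end OfRational

end TropicalCurve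

/-! ### From algebraic data to rational functions -/

namespace TropicalCurve

variable {V E : Type*} {Γ : TropicalCurve V E}

/-- The value at the parameter `t` of the edge `e` of the function with vertex values `x`, initial
slopes `m` and changes of slope prescribed by `D`. -/
noncomputable def edgeValue (D : Γ.Divisor) (x : V → ℝ) (m : E → ℤ) (e : E) (t : ℝ) : ℝ :=
  x (Γ.src e) + m e * t + edgeSum e (fun s => max (t - s) 0) D

/-- The limit of `edgeValue` at the point `∞` of an infinite edge. -/
noncomputable def endValue (D : Γ.Divisor) (x : V → ℝ) (m : E → ℤ) (e : E) : EReal :=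
  -- In `EReal` zero times `⊤` is zero, so a vanishing final slope gives the finite limit.
  (((m e + edgeDeg e D : ℤ) : ℝ) : EReal) * ⊤ + ((x (Γ.src e) - edgeSum e id D : ℝ) : EReal)

open Classical in
/-- The rational function with vertex values `x`, initial slopes `m` and changes of slope
prescribed by `D`. -/
noncomputable def toFunction (D : Γ.Divisor) (x : V → ℝ) (m : E → ℤ) : Γ.Point → EReal
  | .vertex v =>
      if h : ∃ e, Γ.length e = ⊤ ∧ Γ.tgt e = v then endValue D x m h.choose else x v
  | .interior e t _ _ => edgeValue D x m e t

variable {D : Γ.Divisor} {x : V → ℝ} {m : E → ℤ}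

lemma toFunction_isPiecewiseLinearOn (e : E) :
    IsPiecewiseLinearOn (toFunction D x m) e D (x (Γ.src e)) (m e) := by
  intro t ht
  rw [param_of_mem ht.1 ht.2]
  rfl

lemma toFunction_src (e : E) : toFunction D x m (.vertex (Γ.src e)) = x (Γ.src e) := by
  rw [toFunction, dif_neg]
  rintro ⟨e', h, h'⟩
  exact (Γ.infinite_leaf e' h).1 e h'.symm

lemma toFunction_tgt_of_ne_top {e : E} (he : Γ.length e ≠ ⊤) :
    toFunction D x m (.vertex (Γ.tgt e)) = x (Γ.tgt e) := by
  rw [toFunction, dif_neg]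
  rintro ⟨e', h, h'⟩
  exact he ((Γ.infinite_leaf e' h).2 e h'.symm ▸ h)

lemma toFunction_tgt_of_top {e : E} (he : Γ.length e = ⊤) :
    toFunction D x m (.vertex (Γ.tgt e)) = endValue D x m e := by
  have hex : ∃ e', Γ.length e' = ⊤ ∧ Γ.tgt e' = Γ.tgt e := ⟨e, he, rfl⟩
  rw [toFunction, dif_pos hex, (Γ.infinite_leaf e he).2 _ hex.choose_spec.2]

lemma continuous_edgeValue (D : Γ.Divisor) (x : V → ℝ) (m : E → ℤ) (e : E) :
    Continuous (edgeValue D x m e) :=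
  (by fun_prop : Continuous fun t : ℝ => x (Γ.src e) + m e * t).add (continuous_edgeSum_max D e)

lemma edgeValue_eq_of_le {e : E} {t : ℝ} (h : ∀ s ∈ (edgePart e D).support, s ≤ t) :
    edgeValue D x m e t = (m e + edgeDeg e D : ℤ) * t + (x (Γ.src e) - edgeSum e id D) := by
  classical
  rw [edgeValue, edgeSum_max_eq D e (fun _ => True) t
    fun s hs => ⟨fun _ => h s hs, fun h => absurd trivial h⟩, edgeDeg_apply, edgeSum_apply]
  simp only [Finset.filter_true, Finsupp.sum, id]
  push_cast
  ring

lemma continuousAt_mul_add_top (M : ℤ) (c : ℝ) :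
    ContinuousAt (fun t : EReal => ((M : ℝ) : EReal) * t + (c : EReal)) ⊤ := by
  have h1 : ContinuousAt (fun t : EReal => ((M : ℝ) : EReal) * t) ⊤ :=
    EReal.Tendsto.const_mul tendsto_id (Or.inl (EReal.coe_ne_bot _)) (Or.inl (EReal.coe_ne_top _))
  exact (EReal.continuousAt_add (p := (((M : ℝ) : EReal) * ⊤, (c : EReal)))
    (Or.inr (EReal.coe_ne_bot c)) (Or.inr (EReal.coe_ne_top c))).comp
    (f := fun t : EReal => (((M : ℝ) : EReal) * t, (c : EReal))) (h1.prodMk continuousAt_const)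

lemma toFunction_param_coe_of_mem {e : E} {t : ℝ} (ht : t ∈ Γ.interval e) :
    toFunction D x m (Γ.param e t) = edgeValue D x m e t :=
  toFunction_isPiecewiseLinearOn e t ht

lemma continuous_toFunction_param [Fintype E] (h : IsDivisorOf D x m) (e : E) :
    Continuous fun t : Set.Icc (0 : EReal) (Γ.length e) => toFunction D x m (Γ.param e t) := by
  have hval : ∀ t : ℝ, 0 ≤ t → (t : EReal) ≤ Γ.length e →
      toFunction D x m (Γ.param e t) = edgeValue D x m e t := by
    intro t h0 h1
    rcases h0.eq_or_lt with rfl | h0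
    · rw [EReal.coe_zero, param_zero, toFunction_src, edgeValue, edgeSum_max_zero]
      simp
    rcases h1.eq_or_lt with h1 | h1
    · have hne : Γ.length e ≠ ⊤ := h1 ▸ EReal.coe_ne_top t
      have ht : t = Γ.len e := by
        rw [← Γ.coe_len hne] at h1
        exact_mod_cast h1
      rw [h1, param_length, toFunction_tgt_of_ne_top hne, edgeValue, ht, edgeSum_max_len D hne,
        EReal.coe_eq_coe_iff]
      linarith [h.1 e]
    · exact toFunction_param_coe_of_mem ⟨h0, h1⟩
  suffices hc : ContinuousOn (fun t : EReal => toFunction D x m (Γ.param e t))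
      (Set.Icc 0 (Γ.length e)) by
    rw [continuousOn_iff_continuous_domRestrict] at hc
    exact hc
  intro t ht
  have hbot : t ≠ ⊥ := fun h => by simp [h] at ht
  by_cases htop : t = ⊤
  · have hlen : Γ.length e = ⊤ := top_le_iff.1 (htop ▸ ht.2)
    subst htop
    refine ContinuousAt.continuousWithinAt ?_
    refine (continuousAt_mul_add_top (m e + edgeDeg e D) (x (Γ.src e) - edgeSum e id D)).congr ?_
    -- Beyond `R` all chips of the edge are passed and the function is affine; including `0` makes
    -- such parameters non-negative.
    obtain ⟨R, hR⟩ := ((edgePart e D).support ∪ {0}).bddAbove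
    filter_upwards [lt_mem_nhds (EReal.coe_lt_top R)] with s hs
    induction s with
    | bot => simp at hs
    | top =>
      rw [← hlen, param_length, toFunction_tgt_of_top hlen, endValue, hlen]
    | coe s =>
      have hs : R < s := by exact_mod_cast hs
      have hle : ∀ r ∈ (edgePart e D).support, r ≤ s := fun r hr =>
        (hR (by simp only [Finset.coe_union, Set.mem_union, Finset.mem_coe]; exact Or.inl hr)).trans
          hs.le
      have h0 : 0 ≤ s := (hR (by simp)).trans hs.le
      rw [hval s h0 (hlen ▸ le_top), edgeValue_eq_of_le hle]
      push_cast
      rfl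
  · have hc : ContinuousAt (fun t : EReal => ((edgeValue D x m e t.toReal : ℝ) : EReal)) t :=
      (continuous_coe_real_ereal.comp (continuous_edgeValue D x m e)).continuousAt.comp
        (EReal.tendsto_toReal htop hbot)
    refine hc.continuousWithinAt.congr_of_eventuallyEq ?_ ?_
    · filter_upwards [self_mem_nhdsWithin,
        mem_nhdsWithin_of_mem_nhds (isOpen_ne.mem_nhds htop)] with s hs hs'
      have h1 : s ≠ ⊥ := fun h => by simp [h] at hs
      lift s to ℝ using ⟨hs', h1⟩
      exact hval s (by exact_mod_cast hs.1) hs.2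
    · lift t to ℝ using ⟨htop, hbot⟩
      exact hval t (by exact_mod_cast ht.1) ht.2

/-- Algebraically principal divisors are divisors of rational functions. -/
theorem IsDivisorOf.exists_isRational [Fintype E] (h : IsDivisorOf D x m) :
    ∃ f, Γ.IsRational f ∧ ∀ p, D p = Γ.ord f p := by
  classical
  refine ⟨toFunction D x m, ⟨continuous_iff_param.2 (continuous_toFunction_param h), ?_, ?_⟩, ?_⟩
  · rintro (v | ⟨e, t, h0, h1⟩) hp
    · by_cases hex : ∃ e, Γ.length e = ⊤ ∧ Γ.tgt e = v
      · obtain ⟨e, he, rfl⟩ := hex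
        exact ⟨e, he, rfl⟩
      · rw [toFunction, dif_neg hex] at hp
        simp at hp
    · simp [toFunction] at hp
  · intro e
    refine ⟨(edgePart e D).support, fun a b h0 h1 hS => ?_⟩
    refine ⟨m e + ∑ s ∈ (edgePart e D).support with s ≤ a, edgePart e D s,
      x (Γ.src e) - ∑ s ∈ (edgePart e D).support with s ≤ a, (edgePart e D s : ℝ) * s,
      fun t ht => ?_⟩
    rw [toFunction_isPiecewiseLinearOn e t
        ⟨h0.trans_lt ht.1, (EReal.coe_lt_coe_iff.2 ht.2).trans_le h1⟩,
      edgeSum_max_eq D e (fun s => s ≤ a) t, EReal.coe_eq_coe_iff]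
    · push_cast
      ring
    · intro s hs
      refine ⟨fun h => h.trans ht.1.le, fun h => ?_⟩
      have := hS s hs
      simp only [Set.mem_Ioo, not_and, not_lt] at this
      exact ht.2.le.trans (this (not_le.1 h))
  · rintro (v | ⟨e, t, h0, h1⟩)
    · rw [ord]
      simp only [(toFunction_isPiecewiseLinearOn _).slope_start,
        (toFunction_isPiecewiseLinearOn _).slope_end]
      exact h.2 v
    · rw [ord, (toFunction_isPiecewiseLinearOn e).slope_sub_slope ⟨h0, h1⟩, edgePart_apply_of_mem]

/-! ### Linear systems and algebraic effectivity -/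

variable [Fintype E]

lemma equivalent_iff {D D' : Γ.Divisor} :
    Γ.Equivalent D' D ↔ ∃ (x : V → ℝ) (m : E → ℤ), IsDivisorOf (D' - D) x m := by
  constructor
  · rintro ⟨f, hf, h⟩
    exact hf.exists_isDivisorOf fun p => by rw [Finsupp.sub_apply, h p, add_sub_cancel_left]
  · rintro ⟨x, m, h⟩
    obtain ⟨f, hf, h⟩ := h.exists_isRational
    exact ⟨f, hf, fun p => by rw [← h p, Finsupp.sub_apply, add_sub_cancel]⟩

lemma eff_of_mem_linearSystem {D D' : Γ.Divisor} (h : D' ∈ Γ.linearSystem D) : Γ.Eff D := by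
  obtain ⟨x, m, hx⟩ := equivalent_iff.1 h.2
  exact hx.eff h.1

variable [Fintype V]

lemma Eff.exists_mem_linearSystem {D : Γ.Divisor} (h : Γ.Eff D) : ∃ D', D' ∈ Γ.linearSystem D := by
  obtain ⟨D', x, m, h0, h⟩ := h.exists_isDivisorOf
  exact ⟨D', h0, equivalent_iff.2 ⟨x, m, h⟩⟩

lemma linearSystem_eq_empty_iff {D : Γ.Divisor} : Γ.linearSystem D = ∅ ↔ ¬ Γ.Eff D := by
  rw [Set.eq_empty_iff_forall_notMem]
  constructor
  · intro h h'
    obtain ⟨D', hD'⟩ := h'.exists_mem_linearSystem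
    exact h D' hD'
  · intro h D' hD'
    exact h (eff_of_mem_linearSystem hD')

lemma deg_eq_of_mem_linearSystem {D D' : Γ.Divisor} (h : D' ∈ Γ.linearSystem D) :
    deg D' = deg D := by
  obtain ⟨x, m, hx⟩ := equivalent_iff.1 h.2
  have := hx.deg_eq_zero
  rw [deg_sub] at this
  linarith

/-- The zero divisor is equivalent to `-(D' - D)`, and in degree zero effectivity is preserved by
negation. -/
lemma eff_sub_of_mem_linearSystem {D D' : Γ.Divisor} (h : D' ∈ Γ.linearSystem D) :
    Γ.Eff (D' - D) := by
  obtain ⟨x, m, hx⟩ := equivalent_iff.1 h.2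
  have h1 : Γ.Eff (-(D' - D)) := by
    refine IsDivisorOf.eff (D' := 0) (x := x) (m := m) ?_ le_rfl
    rwa [zero_sub, neg_neg]
  have h2 := h1.neg (by
    rw [neg_sub, deg_sub, deg_eq_of_mem_linearSystem h, sub_self])
  rwa [neg_neg] at h2

end TropicalCurve

/-! ### The moderator of a non-effective divisor -/

namespace TropicalCurve

variable {V E : Type*} {Γ : TropicalCurve V E}

/-- `ρ` is the distance to `q`. The base vertex is kept away from the unbounded ends so that
feasibility holds at all of them; the source of an edge is never such an end. -/
lemma IsConnected.exists_isRank (hΓ : Γ.IsConnected) :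
    ∃ (q : V) (ρ : V → ℕ), (∀ e, Γ.length e = ⊤ → Γ.tgt e ≠ q) ∧ Γ.darts.IsRank q ρ := by
  obtain ⟨v₀⟩ := hΓ.nonempty
  obtain ⟨q, hq⟩ : ∃ q, ∀ e, Γ.length e = ⊤ → Γ.tgt e ≠ q := by
    by_cases h : ∃ e, Γ.length e = ⊤ ∧ Γ.tgt e = v₀
    · obtain ⟨e, -, -⟩ := h
      exact ⟨Γ.src e, fun e' he' h' => (Γ.infinite_leaf e' he').1 e h'.symm⟩
    · exact ⟨v₀, fun e he h' => h ⟨e, he, h'⟩⟩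
  let H := SimpleGraph.fromRel fun u v => ∃ e, Γ.src e = u ∧ Γ.tgt e = v
  refine ⟨q, fun v => H.dist v q, hq, fun v hv => ?_⟩
  obtain ⟨w, hw⟩ := hΓ.exists_walk_length_eq_dist v q
  cases w with
  | nil => exact absurd rfl hv
  | @cons _ u _ hadj w' =>
    have hlt : H.dist u q < H.dist v q := by
      rw [show H.dist v q = _ from hw.symm, SimpleGraph.Walk.length_cons]
      exact Nat.lt_succ_of_le (SimpleGraph.dist_le w')
    rw [SimpleGraph.fromRel_adj] at hadj
    rcases hadj.2 with ⟨e, h1, h2⟩ | ⟨e, h1, h2⟩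
    · refine ⟨.inl e, h1, ?_⟩
      rw [show Γ.darts.head (.inl e) = Γ.tgt e from rfl, h2]
      exact hlt
    · refine ⟨.inr e, h2, ?_⟩
      rw [show Γ.darts.head (.inr e) = Γ.src e from rfl, h1]
      exact hlt

lemma deg_nonneg {D : Γ.Divisor} (h : 0 ≤ D) : 0 ≤ deg D :=
  Finset.sum_nonneg fun p _ => h p

variable [Fintype E]

open Classical in
lemma valence_eq_card (v : V) :
    Γ.valence v = ((Finset.univ.filter fun a => Γ.darts.tail a = v).card : ℤ) := by
  rw [Finset.card_filter, Fintype.sum_sum_type, valence]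
  push_cast
  rfl

lemma eff_of_nonneg {D : Γ.Divisor} (h : 0 ≤ D) : Γ.Eff D := by
  refine IsDivisorOf.eff (D' := D) (x := 0) (m := 0) ⟨fun e => ?_, fun v => ?_⟩ h
  · simp [shift]
  · simp [vertexPart]

variable [Fintype V]

lemma vertexPart_canonical (v : V) : vertexPart Γ.canonical v = Γ.valence v - 2 := by
  classical
  simp [vertexPart, canonical, Finsupp.single_apply]

lemma edgePart_canonical (e : E) : edgePart e Γ.canonical = 0 := by
  rw [canonical, map_sum]
  exact Finset.sum_eq_zero fun v _ => edgePart_single_vertex e v _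

lemma shift_canonical : shift Γ.canonical = 0 := by
  ext a
  rw [shift, edgeSum_apply, edgePart_canonical]
  simp

lemma deg_canonical : deg Γ.canonical = 2 * Γ.genus - 2 := by
  classical
  rw [deg_eq_sum]
  simp only [vertexPart_canonical, edgeDeg_apply, edgePart_canonical, Finsupp.sum_zero_index,
    Finset.sum_const_zero, add_zero, valence, genus, Finset.sum_sub_distrib, Finset.sum_add_distrib]
  rw [Finset.sum_comm, Finset.sum_comm (s := Finset.univ (α := V))]
  simp
  ring

/-- Every divisor with empty linear system is dominated, up to equivalence, by the divisor of an
acyclic orientation. -/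
theorem exists_moderator (hΓ : Γ.IsConnected) {D : Γ.Divisor} (hD : ¬ Γ.Eff D) :
    ∃ ν : Γ.Divisor, ¬ Γ.Eff ν ∧ ¬ Γ.Eff (Γ.canonical - ν) ∧ deg ν = Γ.genus - 1 ∧
      Γ.Eff (ν - D) := by
  classical
  have : Nonempty V := hΓ.nonempty
  obtain ⟨q, ρ, hq, hρ⟩ := hΓ.exists_isRank
  obtain ⟨x, h, hinj, hfeas, hnet⟩ :=
    Γ.darts.exists_order_of_not_effective q ρ hρ (vertexPart D) (shift D) hD
  set u : E ⊕ E → ℝ := Γ.darts.rise (shift D) x with hu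
  have huN : ∀ e, u (.inr e) = edgeDeg e D - u (.inl e) := fun e => by
    rw [← rise_inl_add_inr D x e]
    simp [u]
  have hint : ∀ a : E ⊕ E, Int.fract (u a) = 0 ↔ Int.fract (u (.inl (a.elim id id))) = 0 := by
    rintro (e | e)
    · rfl
    · simp only [Sum.elim_inr, id]
      rw [huN, sub_eq_add_neg, Int.fract_intCast_add, Int.fract_neg_eq_zero]
  have hint' : ∀ a, (∃ n : ℤ, u a = n) ↔ Int.fract (u a) = 0 := fun a => by
    rw [Int.fract_eq_zero_iff]
    exact ⟨fun ⟨n, hn⟩ => ⟨n, hn.symm⟩, fun ⟨n, hn⟩ => ⟨n, hn.symm⟩⟩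
  -- These edges are thought of as subdivided at an interior point towards which both halves are
  -- oriented, with coefficient `2 - 1 = 1`. Loops belong here because the order of vertices cannot
  -- orient them.
  let T : E → Prop := fun e => Int.fract (u (.inl e)) ≠ 0 ∨ Γ.src e = Γ.tgt e
  have hTfin : ∀ e, T e → Γ.length e ≠ ⊤ := by
    rintro e (hT | hT) htop
    -- An unbounded end has a non-negative coefficient smaller than its number of integral darts to
    -- earlier vertices. Its only dart is therefore integral.
    · have h1 := (hfeas (Γ.tgt e) (hq e htop)).trans_lt (hnet (Γ.tgt e))
      obtain ⟨a, ha⟩ := Finset.card_pos.1 (by exact_mod_cast h1)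
      obtain ⟨-, ha, -, hn⟩ := Finset.mem_filter.1 ha
      rcases a with e' | e'
      · exact (Γ.infinite_leaf e htop).1 e' ha
      · obtain rfl := (Γ.infinite_leaf e htop).2 e' ha
        exact hT ((hint (.inr e')).1 ((hint' _).1 hn))
    · exact (Γ.infinite_leaf e htop).1 e hT
  let w : E → ℤ := fun e => if T e then 1 else 0
  let p : E → ℝ := fun e => if Int.fract (u (.inl e)) = 0 then Γ.len e / 2
    else Γ.len e * (1 - Int.fract (u (.inl e)))
  have hp' : ∀ e, 0 < p e ∧ p e < Γ.len e := by
    intro e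
    have h1 := Γ.len_pos e
    have h2 := Int.fract_lt_one (u (.inl e))
    simp only [p]
    split_ifs with h0
    · constructor <;> linarith
    · have h3 := lt_of_le_of_ne (Int.fract_nonneg (u (.inl e))) (Ne.symm h0)
      constructor
      · exact mul_pos h1 (by linarith)
      · nlinarith
  have hp : ∀ e, 0 < p e ∧ (p e : EReal) < Γ.length e := fun e =>
    ⟨(hp' e).1, (EReal.coe_lt_coe_iff.2 (hp' e).2).trans_le (Γ.coe_len_le e)⟩
  let inDarts : V → Finset (E ⊕ E) := fun v => Finset.univ.filter fun a =>
    Γ.darts.tail a = v ∧ ¬ T (a.elim id id) ∧ h (Γ.darts.head a) < h v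
  let ν : Γ.Divisor := build (fun v => ((inDarts v).card : ℤ) - 1) w p hp
  have hlen : ∀ a, Γ.darts.len a = Γ.len (a.elim id id) := by rintro (e | e) <;> rfl
  have hνT : ∀ a, T (a.elim id id) → 0 < shift ν a ∧ shift ν a < Γ.darts.len a := by
    intro a ha
    have h1 := hTfin _ ha
    have h2 := hp' (a.elim id id)
    rw [hlen, shift_build]
    rcases a with e | e <;> simp only [Sum.elim_inl, Sum.elim_inr, id] at ha h1 h2 ⊢ <;>
      simp only [w, ha, weight, h1, if_true, if_false, Int.cast_one, one_mul] <;>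
      constructor <;> linarith
  have hνnT : ∀ a, ¬ T (a.elim id id) → shift ν a = 0 := by
    intro a ha
    rw [shift_build]
    simp [w, ha]
  refine ⟨ν, ?_, ?_, ?_, ?_⟩
  · refine Γ.darts.not_effective_of_order h (fun a => ?_) fun v => ?_
    · by_cases ha : T (a.elim id id)
      · exact (hνT a ha).2
      · rw [hνnT a ha]
        exact Γ.darts.len_pos a
    · rw [vertexPart_build]
      have h1 : (inDarts v).card ≤ (Finset.univ.filter fun a => Γ.darts.tail a = v ∧
          (shift ν a < 0 ∨ shift ν a ≤ 0 ∧ h (Γ.darts.head a) < h v)).card := by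
        refine Finset.card_le_card fun a ha => ?_
        obtain ⟨-, h1, h2, h3⟩ := Finset.mem_filter.1 ha
        exact Finset.mem_filter.2 ⟨Finset.mem_univ _, h1, Or.inr ⟨(hνnT a h2).le, h3⟩⟩
      omega
  -- Reverse the order: every dart at `v` is either incoming for `ν` or counted for `K - ν`.
  -- Injectivity of `h` leaves only loops as ties, and these are in `T`.
  · have hsh : shift (Γ.canonical - ν) = -shift ν := by rw [shift_sub, shift_canonical, zero_sub]
    refine Γ.darts.not_effective_of_order (fun v => OrderDual.toDual (h v)) (fun a => ?_)
      fun v => ?_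
    · rw [hsh, Pi.neg_apply]
      by_cases ha : T (a.elim id id)
      · linarith [(hνT a ha).1, Γ.darts.len_pos a]
      · rw [hνnT a ha, neg_zero]
        exact Γ.darts.len_pos a
    · rw [vertexPart_sub, Pi.sub_apply, vertexPart_canonical, vertexPart_build, valence_eq_card,
        hsh]
      have h1 : (Finset.univ.filter fun a => Γ.darts.tail a = v) ⊆ inDarts v ∪
          (Finset.univ.filter fun a => Γ.darts.tail a = v ∧ ((-shift ν) a < 0 ∨
            (-shift ν) a ≤ 0 ∧
              OrderDual.toDual (h (Γ.darts.head a)) < OrderDual.toDual (h v))) := by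
        intro a ha
        have ha := (Finset.mem_filter.1 ha).2
        simp only [inDarts, Finset.mem_union, Finset.mem_filter, Finset.mem_univ, true_and, ha,
          Pi.neg_apply, OrderDual.toDual_lt_toDual]
        by_cases hT : T (a.elim id id)
        · exact Or.inr (Or.inl (neg_neg_of_pos (hνT a hT).1))
        · rcases lt_trichotomy (h (Γ.darts.head a)) (h v) with hl | hl | hl
          · exact Or.inl ⟨hT, hl⟩
          · refine absurd (Or.inr ?_) hT
            have := hinj hl
            rcases a with e | e
            · exact ha.trans this.symm
            · exact this.trans ha.symm
          · exact Or.inr (Or.inr ⟨by rw [hνnT a hT, neg_zero], hl⟩)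
      have h2 := (Finset.card_le_card h1).trans (Finset.card_union_le _ _)
      omega
  -- Each edge contributes exactly one to the degree, by its inner chip or by one of its two darts,
  -- and each vertex subtracts one.
  · have h1 : ∑ v, ((inDarts v).card : ℤ) = ∑ e, (1 - w e) := by
      simp only [inDarts, Finset.card_filter]
      push_cast
      rw [Finset.sum_comm]
      have h2 : ∀ a : E ⊕ E, (∑ v, if Γ.darts.tail a = v ∧ ¬ T (a.elim id id) ∧
          h (Γ.darts.head a) < h v then (1 : ℤ) else 0) =
          if ¬ T (a.elim id id) ∧ h (Γ.darts.head a) < h (Γ.darts.tail a) then 1 else 0 := by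
        intro a
        rw [Finset.sum_eq_single (Γ.darts.tail a)]
        · simp
        · intro v _ hv
          simp [hv.symm]
        · simp
      rw [Finset.sum_congr rfl fun a _ => h2 a, Fintype.sum_sum_type, ← Finset.sum_add_distrib]
      refine Finset.sum_congr rfl fun e _ => ?_
      simp only [Sum.elim_inl, Sum.elim_inr, id]
      rw [show Γ.darts.head (.inl e) = Γ.tgt e from rfl,
        show Γ.darts.head (.inr e) = Γ.src e from rfl,
        show Γ.darts.tail (.inl e) = Γ.src e from rfl,
        show Γ.darts.tail (.inr e) = Γ.tgt e from rfl]
      by_cases hT : T e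
      · simp [w, hT]
      · have hne : h (Γ.src e) ≠ h (Γ.tgt e) := fun h' => hT (Or.inr (hinj h'))
        rcases lt_or_gt_of_ne hne with hl | hl <;> simp [w, hT, hl, hl.not_gt]
    rw [deg_eq_sum, vertexPart_build, Finset.sum_sub_distrib, h1,
      Finset.sum_congr rfl fun e _ => edgeDeg_build _ w p hp e, Finset.sum_sub_distrib, genus]
    simp
    ring
  -- With vertex values `-x`, the shift of `ν` absorbs the fractional parts, so every floor is
  -- exactly negated. The coefficient at `v` becomes the indegree minus one minus the old `net`,
  -- which is non-negative.
  · have hfr : ∀ a, 0 ≤ shift ν a / Γ.darts.len a - Int.fract (u a) ∧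
        shift ν a / Γ.darts.len a - Int.fract (u a) < 1 := by
      intro a
      have hl := Γ.darts.len_pos a
      by_cases h0 : Int.fract (u a) = 0
      · rw [h0, sub_zero]
        by_cases ha : T (a.elim id id)
        · have := hνT a ha
          exact ⟨(div_pos this.1 hl).le, (div_lt_one hl).2 this.2⟩
        · simp [hνnT a ha]
      · have h1 : Int.fract (u (.inl (a.elim id id))) ≠ 0 := fun h => h0 ((hint a).2 h)
        have hT : T (a.elim id id) := Or.inl h1
        have h2 := hTfin _ hT
        suffices hs : shift ν a / Γ.darts.len a = Int.fract (u a) by simp [hs]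
        rw [div_eq_iff hl.ne', hlen, shift_build]
        rcases a with e | e <;> simp only [Sum.elim_inl, Sum.elim_inr, id] at hT h1 h2 ⊢
        · simp only [w, hT, weight, h1, h2, p, if_true, if_false, Int.cast_one, one_mul]
          ring
        · rw [huN, sub_eq_add_neg, Int.fract_intCast_add, Int.fract_neg h1]
          simp only [w, hT, weight, h1, h2, p, if_true, if_false, Int.cast_one, one_mul]
          ring
    have hfl : ∀ a, ⌊Γ.darts.rise (shift (ν - D)) (-x) a⌋ = -⌊u a⌋ := by
      intro a
      have h1 : Γ.darts.rise (shift (ν - D)) (-x) a = shift ν a / Γ.darts.len a - u a := by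
        rw [shift_sub, hu]
        simp only [DartGraph.rise, Pi.sub_apply, Pi.neg_apply]
        ring
      have h2 := Int.floor_add_fract (u a)
      rw [h1, Int.floor_eq_iff]
      push_cast
      constructor <;> linarith [(hfr a).1, (hfr a).2]
    refine ⟨-x, fun v => ?_⟩
    have h1 := hnet v
    have h2 : (Finset.univ.filter fun a => Γ.darts.tail a = v ∧ h (Γ.darts.head a) < h v ∧
        ∃ n : ℤ, u a = n).card ≤ (inDarts v).card := by
      refine Finset.card_le_card fun a ha => ?_
      obtain ⟨-, h1, h2, h3⟩ := Finset.mem_filter.1 ha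
      refine Finset.mem_filter.2 ⟨Finset.mem_univ _, h1, ?_, h2⟩
      rintro (hT | hT)
      · exact hT ((hint a).1 ((hint' a).1 h3))
      · have : Γ.darts.head a = v := by
          rcases a with e | e
          · exact hT.symm.trans h1
          · exact hT.trans h1
        rw [this] at h2
        exact lt_irrefl _ h2
    simp only [DartGraph.net, hfl, Finset.sum_neg_distrib] at h1 ⊢
    rw [vertexPart_sub, Pi.sub_apply, vertexPart_build]
    have h3 : ((Finset.univ.filter fun a => Γ.darts.tail a = v ∧ h (Γ.darts.head a) < h v ∧
        ∃ n : ℤ, u a = n).card : ℤ) ≤ (inDarts v).card := by exact_mod_cast h2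
    linarith

/-! ### The conditions (RR1) and (RR2), and Riemann–Roch -/

lemma not_eff_of_deg_neg {D : Γ.Divisor} (h : deg D < 0) : ¬ Γ.Eff D :=
  fun h' => h'.deg_nonneg.not_gt h

lemma eps_of_eff {D : Γ.Divisor} (h : Γ.Eff D) : Γ.eps D = 0 :=
  if_neg fun h' => linearSystem_eq_empty_iff.1 h' h

lemma eps_of_not_eff {D : Γ.Divisor} (h : ¬ Γ.Eff D) : Γ.eps D = 1 :=
  if_pos (linearSystem_eq_empty_iff.2 h)

lemma exists_nonSpecial (hΓ : Γ.IsConnected) : ∃ ν, ν ∈ Γ.nonSpecial := by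
  obtain ⟨v⟩ := hΓ.nonempty
  have h : deg (Finsupp.single (.vertex v) (-1) : Γ.Divisor) = -1 := Finsupp.sum_single_index rfl
  obtain ⟨ν, h1, -, h2, -⟩ := exists_moderator hΓ (not_eff_of_deg_neg (by rw [h]; norm_num))
  exact ⟨ν, h2, linearSystem_eq_empty_iff.2 h1⟩

/-- For effective `D` any `ν` serves, because effectivity of `ν - D` would make `ν` effective.
Otherwise the moderator of `D` serves. -/
theorem IsConnected.rr1 (hΓ : Γ.IsConnected) : Γ.RR1 := by
  intro D
  by_cases hD : Γ.Eff D
  · obtain ⟨ν, hν⟩ := exists_nonSpecial hΓ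
    refine ⟨ν, hν, ?_⟩
    rw [eps_of_eff hD, eps_of_not_eff, zero_add]
    intro h
    have := hD.add h
    rw [add_sub_cancel] at this
    exact linearSystem_eq_empty_iff.1 hν.2 this
  · obtain ⟨ν, h1, -, h2, h3⟩ := exists_moderator hΓ hD
    refine ⟨ν, ⟨h2, linearSystem_eq_empty_iff.2 h1⟩, ?_⟩
    rw [eps_of_not_eff hD, eps_of_eff h3, add_zero]

/-- In degree `g - 1` the difference `ν - D` has degree zero, so its negative is effective too and
`K - D` would pass its effectivity on to `K - ν`. -/
lemma not_eff_canonical_sub (hΓ : Γ.IsConnected) {D : Γ.Divisor} (hdeg : deg D = Γ.genus - 1)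
    (hD : ¬ Γ.Eff D) : ¬ Γ.Eff (Γ.canonical - D) := by
  obtain ⟨ν, -, h1, h2, h3⟩ := exists_moderator hΓ hD
  intro h
  have h4 := h.add (h3.neg (by rw [deg_sub, h2, hdeg, sub_self]))
  rw [neg_sub, sub_add_sub_cancel] at h4
  exact h1 h4

theorem IsConnected.rr2 (hΓ : Γ.IsConnected) : Γ.RR2 := by
  intro D hdeg
  by_cases hD : Γ.Eff D
  · have hKD : Γ.Eff (Γ.canonical - D) := by
      by_contra h
      refine not_eff_canonical_sub hΓ ?_ h (by rwa [sub_sub_cancel])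
      rw [deg_sub, deg_canonical, hdeg]
      ring
    rw [eps_of_eff hD, eps_of_eff hKD, add_zero]
  · rw [eps_of_not_eff hD, eps_of_not_eff (not_eff_canonical_sub hΓ hdeg hD)]
    decide

/-- A divisor `F'` in `|ν - (D - F)|` is the witness for `K - D`: adding `F` and a principal divisor
turns `K - D - F'` into `K - ν`. -/
lemma sub_mem_rankSet (hΓ : Γ.IsConnected) {D : Γ.Divisor} {n : ℤ} (hn : n ∈ Γ.rankSet D) :
    n - (deg D + 1 - Γ.genus) ∈ Γ.rankSet (Γ.canonical - D) := by
  obtain ⟨F, hF, hempty, rfl⟩ := hn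
  obtain ⟨ν, -, h1, h2, h3⟩ := exists_moderator hΓ (linearSystem_eq_empty_iff.1 hempty)
  obtain ⟨F', hF'⟩ := h3.exists_mem_linearSystem
  refine ⟨F', hF'.1, linearSystem_eq_empty_iff.2 fun h => h1 ?_, ?_⟩
  · have := (h.add (eff_sub_of_mem_linearSystem hF')).add (eff_of_nonneg hF)
    convert this using 1
    abel
  · rw [deg_eq_of_mem_linearSystem hF', deg_sub, deg_sub, h2]
    ring

/-- Degrees of effective divisors bound the set below by `-1`, and subtracting more than `deg D`
chips leaves negative degree, so the infimum is attained. -/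
lemma isLeast_rank (hΓ : Γ.IsConnected) (D : Γ.Divisor) : IsLeast (Γ.rankSet D) (Γ.rank D) := by
  have hbdd : BddBelow (Γ.rankSet D) := by
    refine ⟨-1, ?_⟩
    rintro _ ⟨F, hF, -, rfl⟩
    linarith [deg_nonneg hF]
  have hne : (Γ.rankSet D).Nonempty := by
    obtain ⟨v⟩ := hΓ.nonempty
    let F : Γ.Divisor := Finsupp.single (.vertex v) (max (deg D + 1) 0)
    have hF : deg F = max (deg D + 1) 0 := Finsupp.sum_single_index rfl
    refine ⟨_, F, Finsupp.single_nonneg.2 (le_max_right _ _),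
      linearSystem_eq_empty_iff.2 (not_eff_of_deg_neg ?_), rfl⟩
    rw [deg_sub, hF]
    linarith [le_max_left (deg D + 1) 0]
  exact ⟨Int.csInf_mem hne hbdd, fun n hn => csInf_le hbdd hn⟩

lemma rank_canonical_sub_le (hΓ : Γ.IsConnected) (D : Γ.Divisor) :
    Γ.rank (Γ.canonical - D) ≤ Γ.rank D - (deg D + 1 - Γ.genus) :=
  (isLeast_rank hΓ _).2 (sub_mem_rankSet hΓ (isLeast_rank hΓ D).1)

theorem riemannRoch (hΓ : Γ.IsConnected) (D : Γ.Divisor) :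
    Γ.rank D - Γ.rank (Γ.canonical - D) = deg D + 1 - Γ.genus := by
  have h1 := rank_canonical_sub_le hΓ D
  have h2 := rank_canonical_sub_le hΓ (Γ.canonical - D)
  rw [sub_sub_cancel, deg_sub, deg_canonical] at h2
  linarith

end TropicalCurve

theorem mainTheorem1 {V : Type*} {E : Type*} [Fintype V] [Fintype E]
    (Γ : TropicalCurve V E) (hΓ : Γ.IsConnected) :
    (Γ.IsMetricGraph → Γ.RR1 ∧ Γ.RR2) ∧
    (∀ D : Γ.Divisor, IsLeast (Γ.rankSet D) (Γ.rank D)) ∧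
    (∀ D : Γ.Divisor,
      Γ.rank D - Γ.rank (Γ.canonical - D) = TropicalCurve.deg D + 1 - Γ.genus) :=
  ⟨fun _ => ⟨hΓ.rr1, hΓ.rr2⟩, TropicalCurve.isLeast_rank hΓ, TropicalCurve.riemannRoch hΓ⟩
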